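/- Let $\Omega\subset\mathbb R^2$ be a bounded connected (non-empty) open set with $C^3$ boundary. The boundary $\partial\Omega$ is parametrized by arc length: it is the disjoint union of finitely many simple closed curves, the $k$-th one ($1\le k\le N$) of length $L_k>0$ and parametrized by an $L_k$-periodic $C^3$ map $\gamma_k:\mathbb R\to\mathbb R^2$ that is injective on $[0,L_k)$ (if $\partial\Omega$ is connected, there is a single curve $\gamma:[0,L]\to\partial\Omega$). Let $\alpha_k:\mathbb R\to\mathbb R$ be the turning angle, i.e. a continuous function such that $\boldsymbol n_k(s)=(\cos\alpha_k(s),\sin\alpha_k(s))$ is the outward unit normal of $\Omega$ at $\gamma_k(s)$, the curves being oriented so that $\gamma_k'(s)=(-\sin\alpha_k(s),\cos\alpha_k(s))$; thus $\alpha_k'$ is the curvature of $\partial\Omega$. For $\theta\in\mathbb R$ put $a(\theta)=ie^{i\theta}$, $$A(\theta)=\begin{pmatrix}0&\overline{a(\theta)}\\ a(\theta)&0\end{pmatrix},\qquad P_-(\theta)=\tfrac12\bigl(1-A(\theta)\bigr).$$ For $\varphi\in H^1(\Omega,\mathbb C^2)$ let $s\mapsto\varphi(\gamma_k(s))$ denote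 its boundary trace, an element of $L^2((0,L_k),\mathbb C^2)$: it is the limit of $u_n\circ\gamma_k$ in $L^2((0,L_k),\mathbb C^2)$ for smooth functions $u_n:\mathbb R^2\to\mathbb C^2$ whose restrictions to $\Omega$ converge to $\varphi$ in $H^1(\Omega,\mathbb C^2)$. Let $$\mathcal D_\infty=\{\varphi\in H^1(\Omega,\mathbb C^2): P_-(\alpha_k(s))\,\varphi(\gamma_k(s))=0\ \text{ for all } k \text{ and almost every } s\in[0,L_k)\},$$ and let $H_\infty:\mathcal D_\infty\to L^2(\Omega,\mathbb C^2)$ be the operator $$H_\infty\varphi=\tfrac1i\bigl(\sigma_1\partial_1\varphi+\sigma_2\partial_2\varphi\bigr),\qquad \sigma_1=\begin{pmatrix}0&1\\1&0\end{pmatrix},\quad \sigma_2=\begin{pmatrix}0&-i\\ i&0\end{pmatrix},$$ with weak derivatives $\partial_1,\partial_2$. Then for every $\varphi\in\mathcal D_\infty$ $$\|H_\infty\varphi\|_{L^2(\Omega)}^2=\int_\Omega|\nabla\varphi(x)|^2\,dx+\frac12\sum_{k=1}^N\int_0^{L_k}\alpha_k'(s)\,|\varphi(\gamma_k(s))|^2\,ds,$$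 where $|\nabla\varphi|^2=|\partial_1\varphi|^2+|\partial_2\varphi|^2$. If $\partial\Omega$ is a single curve, the last term is $\frac12\int_0^L\alpha'(s)|\varphi(\gamma(s))|^2\,ds$. -/

import Mathlib

open MeasureTheory Filter Topology TopologicalSpace
open scoped ContDiff

noncomputable section

namespace Graphene

/-- The Euclidean plane `ℝ²`. -/
abbrev Plane : Type := EuclideanSpace ℝ (Fin 2)

/-- The space `ℂ²` with its Hermitian norm. -/
abbrev Spinor : Type := EuclideanSpace ℂ (Fin 2)

/-- The Hilbert space `L²(Ω, ℂ²)` (Lebesgue measure on `Ω`). -/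
abbrev L2 (Ω : Opens Plane) : Type :=
  Lp Spinor 2 (volume.restrict (Ω : Set Plane))

/-- The standard basis vector `e_j` of `ℝ²`. -/
abbrev basisVec (j : Fin 2) : Plane := EuclideanSpace.single j (1 : ℝ)

/-! ### The Sobolev space `H¹(Ω, ℂ²)` and weak partial derivatives -/

/-- `v` is the weak partial derivative `∂_j u` in `Ω`, tested against `C_c^∞(Ω)`. -/
def HasWeakPartial (Ω : Opens Plane) (j : Fin 2) (u v : L2 Ω) : Prop :=
  ∀ η : Plane → ℝ, ContDiff ℝ ∞ η → HasCompactSupport η → tsupport η ⊆ (Ω : Set Plane) →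
    ∫ x in (Ω : Set Plane), (fderiv ℝ η x (basisVec j)) • u x =
      - ∫ x in (Ω : Set Plane), η x • v x

theorem integrable_test_smul {Ω : Opens Plane} (u : L2 Ω) {η : Plane → ℝ}
    (hη : Continuous η) (hc : HasCompactSupport η) :
    Integrable (fun x => η x • u x) (volume.restrict (Ω : Set Plane)) :=
  ((Lp.memLp u).locallyIntegrable (by norm_num)).integrable_smul_left_of_hasCompactSupport hη hc

theorem continuous_fderiv_test {η : Plane → ℝ} (hη : ContDiff ℝ ∞ η) (j : Fin 2) :
    Continuous (fun x => fderiv ℝ η x (basisVec j)) :=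
  (hη.continuous_fderiv (by simp)).clm_apply continuous_const

theorem HasWeakPartial.unique {Ω : Opens Plane} {j : Fin 2} {u v w : L2 Ω}
    (hv : HasWeakPartial Ω j u v) (hw : HasWeakPartial Ω j u w) : v = w := by
  have hloc : ∀ z : L2 Ω, LocallyIntegrable z (volume.restrict (Ω : Set Plane)) :=
    fun z => (Lp.memLp z).locallyIntegrable (by norm_num)
  have key := Ω.isOpen.ae_eq_zero_of_integral_contDiff_smul_eq_zero
    (μ := volume.restrict (Ω : Set Plane)) (f := fun x => v x - w x)
    (((hloc v).sub (hloc w)).locallyIntegrableOn _) (by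
      intro η h1 h2 h3
      have e := (hv η h1 h2 h3).symm.trans (hw η h1 h2 h3)
      simp only [smul_sub]
      rw [integral_sub (integrable_test_smul v h1.continuous h2)
        (integrable_test_smul w h1.continuous h2), neg_injective e, sub_self])
  apply Lp.ext
  filter_upwards [key, ae_restrict_mem Ω.isOpen.measurableSet] with x hx hxΩ
  exact sub_eq_zero.mp (hx hxΩ)

theorem HasWeakPartial.add {Ω : Opens Plane} {j : Fin 2} {u u' v v' : L2 Ω}
    (h : HasWeakPartial Ω j u v) (h' : HasWeakPartial Ω j u' v') :
    HasWeakPartial Ω j (u + u') (v + v') := by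
  intro η h1 h2 h3
  have hd := continuous_fderiv_test h1 j
  have hdc : HasCompactSupport (fun x => fderiv ℝ η x (basisVec j)) :=
    h2.fderiv_apply ℝ _
  have e1 : ∫ x in (Ω : Set Plane), (fderiv ℝ η x (basisVec j)) • (u + u') x =
      ∫ x in (Ω : Set Plane), ((fderiv ℝ η x (basisVec j)) • u x +
        (fderiv ℝ η x (basisVec j)) • u' x) := by
    apply integral_congr_ae
    filter_upwards [Lp.coeFn_add u u'] with x hx
    rw [hx, Pi.add_apply, smul_add]
  have e2 : ∫ x in (Ω : Set Plane), η x • (v + v') x =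
      ∫ x in (Ω : Set Plane), (η x • v x + η x • v' x) := by
    apply integral_congr_ae
    filter_upwards [Lp.coeFn_add v v'] with x hx
    rw [hx, Pi.add_apply, smul_add]
  rw [e1, e2, integral_add (integrable_test_smul u hd hdc) (integrable_test_smul u' hd hdc),
    integral_add (integrable_test_smul v h1.continuous h2)
      (integrable_test_smul v' h1.continuous h2), h η h1 h2 h3, h' η h1 h2 h3]
  abel

theorem HasWeakPartial.smul {Ω : Opens Plane} {j : Fin 2} {u v : L2 Ω}
    (c : ℂ) (h : HasWeakPartial Ω j u v) : HasWeakPartial Ω j (c • u) (c • v) := by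
  intro η h1 h2 h3
  have e1 : ∫ x in (Ω : Set Plane), (fderiv ℝ η x (basisVec j)) • (c • u) x =
      ∫ x in (Ω : Set Plane), c • ((fderiv ℝ η x (basisVec j)) • u x) := by
    apply integral_congr_ae
    filter_upwards [Lp.coeFn_smul c u] with x hx
    rw [hx, Pi.smul_apply, smul_comm]
  have e2 : ∫ x in (Ω : Set Plane), η x • (c • v) x =
      ∫ x in (Ω : Set Plane), c • (η x • v x) := by
    apply integral_congr_ae
    filter_upwards [Lp.coeFn_smul c v] with x hx
    rw [hx, Pi.smul_apply, smul_comm]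
  rw [e1, e2, integral_smul, integral_smul, h η h1 h2 h3, smul_neg]

theorem HasWeakPartial.zero (Ω : Opens Plane) (j : Fin 2) :
    HasWeakPartial Ω j (0 : L2 Ω) 0 := by
  intro η _ _ _
  have e : ∀ f : Plane → ℝ,
      ∫ x in (Ω : Set Plane), f x • (0 : L2 Ω) x = 0 := by
    intro f
    apply integral_eq_zero_of_ae
    filter_upwards [Lp.coeFn_zero Spinor 2 (volume.restrict (Ω : Set Plane))] with x hx
    rw [hx]; simp
  rw [e, e, neg_zero]

/-- The Sobolev space `H¹(Ω, ℂ²)`, as a subspace of `L²(Ω, ℂ²)`. -/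
def sobolevH1 (Ω : Opens Plane) : Submodule ℂ (L2 Ω) where
  carrier := {u | ∀ j, ∃ v, HasWeakPartial Ω j u v}
  add_mem' {u u'} hu hu' := by
    intro j
    obtain ⟨v, hv⟩ := hu j
    obtain ⟨v', hv'⟩ := hu' j
    exact ⟨v + v', hv.add hv'⟩
  zero_mem' j := ⟨0, HasWeakPartial.zero Ω j⟩
  smul_mem' c u hu := by
    intro j
    obtain ⟨v, hv⟩ := hu j
    exact ⟨c • v, hv.smul c⟩

/-- The weak partial derivative `∂_j : H¹(Ω, ℂ²) → L²(Ω, ℂ²)`. -/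
def weakPartial (Ω : Opens Plane) (j : Fin 2) : sobolevH1 Ω →ₗ[ℂ] L2 Ω where
  toFun u := (u.2 j).choose
  map_add' u u' := ((u + u').2 j).choose_spec.unique
    ((u.2 j).choose_spec.add (u'.2 j).choose_spec)
  map_smul' c u := ((c • u).2 j).choose_spec.unique ((u.2 j).choose_spec.smul c)

theorem hasWeakPartial_weakPartial (Ω : Opens Plane) (j : Fin 2) (u : sobolevH1 Ω) :
    HasWeakPartial Ω j (u : L2 Ω) (weakPartial Ω j u) :=
  (u.2 j).choose_spec

/-! ### The Dirac differential expression -/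

/-- The Pauli matrices `σ₁, σ₂` (indexed by `0, 1`). -/
def pauli : Fin 2 → Matrix (Fin 2) (Fin 2) ℂ :=
  ![!![0, 1; 1, 0], !![0, -Complex.I; Complex.I, 0]]

/-- A constant `2 × 2` matrix acting on `ℂ²`. -/
abbrev matAct (M : Matrix (Fin 2) (Fin 2) ℂ) : Spinor →L[ℂ] Spinor :=
  Matrix.toEuclideanCLM (n := Fin 2) (𝕜 := ℂ) M

/-- `T φ = (1/i) (σ₁ ∂₁ φ + σ₂ ∂₂ φ)` for `φ ∈ H¹(Ω, ℂ²)`. -/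
def diracT (Ω : Opens Plane) : sobolevH1 Ω →ₗ[ℂ] L2 Ω :=
  (1 / Complex.I) • ∑ j : Fin 2,
    ((matAct (pauli j)).compLpL 2 (volume.restrict (Ω : Set Plane))).toLinearMap ∘ₗ
      weakPartial Ω j

/-! ### The boundary -/

/-- `∂Ω ∈ C³`: near every boundary point, after a rigid change of coordinates, `Ω` is the set of
points above the graph of a `C³` function. -/
def HasC3Boundary (Ω : Opens Plane) : Prop :=
  ∀ x₀ ∈ frontier (Ω : Set Plane), ∃ r > (0 : ℝ), ∃ e : Plane ≃ₗᵢ[ℝ] Plane, ∃ f : ℝ → ℝ,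
    ContDiff ℝ 3 f ∧ ∀ x ∈ Metric.ball x₀ r, x ∈ Ω ↔ f (e x 0) < e x 1

/-- The unit vector `(cos θ, sin θ)`. -/
def normalVec (θ : ℝ) : Plane := !₂[Real.cos θ, Real.sin θ]

/-- The unit vector `(-sin θ, cos θ)`. -/
def tangentVec (θ : ℝ) : Plane := !₂[-Real.sin θ, Real.cos θ]

/-- An arc-length parametrization of `∂Ω` together with its turning angle. The boundary consists of
finitely many simple closed curves (only one if `∂Ω` is connected); the `k`-th one has length
`L k`, is parametrized by the `L k`-periodic map `γ k`, and `α k s` is the angle between the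
`x₁`-axis and the outward unit normal at `γ k s`, chosen continuously in `s`. -/
structure BoundaryParam (Ω : Opens Plane) where
  /-- number of boundary curves -/
  N : ℕ
  /-- lengths -/
  L : Fin N → ℝ
  /-- the curves -/
  γ : Fin N → ℝ → Plane
  /-- the turning angles -/
  α : Fin N → ℝ → ℝ
  L_pos : ∀ k, 0 < L k
  contDiff_γ : ∀ k, ContDiff ℝ 3 (γ k)
  periodic_γ : ∀ k, Function.Periodic (γ k) (L k)
  injective_γ : ∀ k l, ∀ s ∈ Set.Ico 0 (L k), ∀ t ∈ Set.Ico 0 (L l),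
    γ k s = γ l t → k = l ∧ s = t
  range_γ : ⋃ k, Set.range (γ k) = frontier (Ω : Set Plane)
  continuous_α : ∀ k, Continuous (α k)
  /-- `γ'(s) = (-sin α(s), cos α(s))`; in particular `|γ'(s)| = 1` -/
  deriv_γ : ∀ k s, HasDerivAt (γ k) (tangentVec (α k s)) s
  /-- `n(s) = (cos α(s), sin α(s))` points out of `Ω` -/
  outward : ∀ k s, ∀ᶠ t in 𝓝[>] (0 : ℝ),
    γ k s - t • normalVec (α k s) ∈ Ω ∧ γ k s + t • normalVec (α k s) ∉ Ω

/-- The measure `ds` on `[0, L k]`. -/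
abbrev BoundaryParam.arcMeasure {Ω : Opens Plane} (Γ : BoundaryParam Ω) (k : Fin Γ.N) :
    Measure ℝ :=
  volume.restrict (Set.Ioc 0 (Γ.L k))

/-- `L²(∂Ω, ℂ²)`, in the arc-length coordinate on each boundary curve. -/
abbrev BoundaryParam.L2Boundary {Ω : Opens Plane} (Γ : BoundaryParam Ω) : Type :=
  ∀ k : Fin Γ.N, Lp Spinor 2 (Γ.arcMeasure k)

/-- `g` is the trace `s ↦ φ(γ(s))` of `φ ∈ H¹(Ω, ℂ²)` on the boundary: the trace map is the
continuous extension of the restriction `u ↦ u ∘ γ` from functions `u` smooth up to the boundary,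
that is, `uₙ ∘ γ → g` in `L²(∂Ω)` for smooth `uₙ` with `uₙ → φ` in `H¹(Ω)`. -/
def BoundaryParam.IsTrace {Ω : Opens Plane} (Γ : BoundaryParam Ω) (φ : sobolevH1 Ω)
    (g : Γ.L2Boundary) : Prop :=
  ∃ u : ℕ → Plane → Spinor, (∀ n, ContDiff ℝ ∞ (u n)) ∧
    Tendsto (fun n => eLpNorm (fun x => u n x - (φ : L2 Ω) x) 2
      (volume.restrict (Ω : Set Plane))) atTop (𝓝 0) ∧
    (∀ j, Tendsto (fun n => eLpNorm
      (fun x => fderiv ℝ (u n) x (basisVec j) - weakPartial Ω j φ x) 2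
      (volume.restrict (Ω : Set Plane))) atTop (𝓝 0)) ∧
    ∀ k, Tendsto (fun n => eLpNorm (fun s => u n (Γ.γ k s) - g k s) 2
      (Γ.arcMeasure k)) atTop (𝓝 0)

/-- The matrix `A` for the turning angle `θ`: off-diagonal entries `a = i e^{iθ}` and `a^*`. -/
def bdMatrix (θ : ℝ) : Matrix (Fin 2) (Fin 2) ℂ :=
  !![0, star (Complex.I * Complex.exp (Complex.I * θ));
    Complex.I * Complex.exp (Complex.I * θ), 0]

/-- The projection `P₋ = (1 - A) / 2`. -/
def projMinus (θ : ℝ) : Matrix (Fin 2) (Fin 2) ℂ := (1 / 2 : ℂ) • (1 - bdMatrix θ)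

/-! ### The operator `H_∞` -/

theorem tendsto_eLpNorm_add {X : Type*} [MeasurableSpace X] {μ : Measure X}
    {f f' : ℕ → X → Spinor} {g g' h : X → Spinor}
    (hf : ∀ n, AEStronglyMeasurable (f n) μ) (hf' : ∀ n, AEStronglyMeasurable (f' n) μ)
    (hg : AEStronglyMeasurable g μ) (hg' : AEStronglyMeasurable g' μ)
    (hh : h =ᵐ[μ] g + g')
    (H : Tendsto (fun n => eLpNorm (fun x => f n x - g x) 2 μ) atTop (𝓝 0))
    (H' : Tendsto (fun n => eLpNorm (fun x => f' n x - g' x) 2 μ) atTop (𝓝 0)) :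
    Tendsto (fun n => eLpNorm (fun x => (f n x + f' n x) - h x) 2 μ) atTop (𝓝 0) := by
  have hs := H.add H'
  rw [add_zero] at hs
  refine tendsto_of_tendsto_of_tendsto_of_le_of_le tendsto_const_nhds hs
    (fun n => zero_le) (fun n => ?_)
  refine le_trans (le_of_eq ?_) (eLpNorm_add_le ((hf n).sub hg) ((hf' n).sub hg')
    (by norm_num))
  apply eLpNorm_congr_ae
  filter_upwards [hh] with x hx
  simp only [hx, Pi.add_apply]
  abel

theorem tendsto_eLpNorm_smul {X : Type*} [MeasurableSpace X] {μ : Measure X}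
    {f : ℕ → X → Spinor} {g h : X → Spinor} (c : ℂ) (hh : h =ᵐ[μ] c • g)
    (H : Tendsto (fun n => eLpNorm (fun x => f n x - g x) 2 μ) atTop (𝓝 0)) :
    Tendsto (fun n => eLpNorm (fun x => c • f n x - h x) 2 μ) atTop (𝓝 0) := by
  have e : ∀ n, eLpNorm (fun x => c • f n x - h x) 2 μ =
      ‖c‖ₑ * eLpNorm (fun x => f n x - g x) 2 μ := by
    intro n
    rw [← eLpNorm_const_smul]
    apply eLpNorm_congr_ae
    filter_upwards [hh] with x hx
    simp only [hx, Pi.smul_apply, smul_sub]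
  simp only [e]
  simpa using ENNReal.Tendsto.const_mul H (Or.inr enorm_ne_top)

theorem BoundaryParam.IsTrace.add {Ω : Opens Plane} {Γ : BoundaryParam Ω} {φ φ' : sobolevH1 Ω}
    {g g' : Γ.L2Boundary} (h : Γ.IsTrace φ g) (h' : Γ.IsTrace φ' g') :
    Γ.IsTrace (φ + φ') (g + g') := by
  obtain ⟨u, hu, h0, h1, h2⟩ := h
  obtain ⟨u', hu', h0', h1', h2'⟩ := h'
  have hm : ∀ {v : Plane → Spinor}, ContDiff ℝ ∞ v → ∀ j : Fin 2,
      Continuous (fun x => fderiv ℝ v x (basisVec j)) := fun hv j =>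
    (hv.continuous_fderiv (by simp)).clm_apply continuous_const
  refine ⟨fun n x => u n x + u' n x, fun n => (hu n).add (hu' n), ?_, fun j => ?_, fun k => ?_⟩
  · exact tendsto_eLpNorm_add (fun n => (hu n).continuous.aestronglyMeasurable)
      (fun n => (hu' n).continuous.aestronglyMeasurable) (Lp.aestronglyMeasurable _)
      (Lp.aestronglyMeasurable _) (Lp.coeFn_add _ _) h0 h0'
  · have e : ∀ n x, fderiv ℝ (fun x => u n x + u' n x) x (basisVec j) =
        fderiv ℝ (u n) x (basisVec j) + fderiv ℝ (u' n) x (basisVec j) := by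
      intro n x
      rw [fderiv_fun_add ((hu n).differentiable (by simp) x)
        ((hu' n).differentiable (by simp) x)]
      rfl
    simp only [e]
    refine tendsto_eLpNorm_add (fun n => (hm (hu n) j).aestronglyMeasurable)
      (fun n => (hm (hu' n) j).aestronglyMeasurable) (Lp.aestronglyMeasurable _)
      (Lp.aestronglyMeasurable _) ?_ (h1 j) (h1' j)
    rw [map_add]
    exact Lp.coeFn_add _ _
  · have hγ := (Γ.contDiff_γ k).continuous
    exact tendsto_eLpNorm_add
      (fun n => ((hu n).continuous.comp hγ).aestronglyMeasurable)
      (fun n => ((hu' n).continuous.comp hγ).aestronglyMeasurable) (Lp.aestronglyMeasurable _)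
      (Lp.aestronglyMeasurable _) (Lp.coeFn_add _ _) (h2 k) (h2' k)

theorem BoundaryParam.IsTrace.smul {Ω : Opens Plane} {Γ : BoundaryParam Ω} {φ : sobolevH1 Ω}
    {g : Γ.L2Boundary} (c : ℂ) (h : Γ.IsTrace φ g) : Γ.IsTrace (c • φ) (c • g) := by
  obtain ⟨u, hu, h0, h1, h2⟩ := h
  refine ⟨fun n x => c • u n x, fun n => (hu n).const_smul c, ?_, fun j => ?_, fun k => ?_⟩
  · exact tendsto_eLpNorm_smul c (Lp.coeFn_smul _ _) h0
  · have e : ∀ n x, fderiv ℝ (fun x => c • u n x) x (basisVec j) =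
        c • fderiv ℝ (u n) x (basisVec j) := by
      intro n x
      rw [fderiv_fun_const_smul ((hu n).differentiable (by simp) x)]
      rfl
    simp only [e]
    refine tendsto_eLpNorm_smul c ?_ (h1 j)
    rw [map_smul]
    exact Lp.coeFn_smul _ _
  · exact tendsto_eLpNorm_smul c (Lp.coeFn_smul _ _) (h2 k)

theorem BoundaryParam.IsTrace.zero {Ω : Opens Plane} (Γ : BoundaryParam Ω) :
    Γ.IsTrace 0 0 := by
  have key : ∀ {X : Type} [MeasurableSpace X] (μ : Measure X) (z : Lp Spinor 2 μ), z = 0 →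
      Tendsto (fun _ : ℕ => eLpNorm (fun x => (0 : Spinor) - z x) 2 μ) atTop (𝓝 0) := by
    intro X _ μ z hz
    have e : eLpNorm (fun x => (0 : Spinor) - z x) 2 μ = 0 := by
      rw [hz, eLpNorm_congr_ae (g := fun _ => (0 : Spinor)) (by
        filter_upwards [Lp.coeFn_zero Spinor 2 μ] with x hx
        rw [hx]; simp)]
      exact eLpNorm_zero' (ε := Spinor)
    rw [e]
    exact tendsto_const_nhds
  refine ⟨fun _ _ => 0, fun _ => contDiff_const, key _ _ rfl, fun j => ?_,
    fun k => key _ _ rfl⟩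
  simpa using key _ _ (map_zero (weakPartial Ω j))

/-- The domain `D_∞` of all `φ ∈ H¹(Ω, ℂ²)` with `P₋(s) φ(γ(s)) = 0` on the boundary. -/
def domInfty {Ω : Opens Plane} (Γ : BoundaryParam Ω) : Submodule ℂ (sobolevH1 Ω) where
  carrier := {φ | ∃ g : Γ.L2Boundary, Γ.IsTrace φ g ∧
    ∀ k, ∀ᵐ s ∂(Γ.arcMeasure k), matAct (projMinus (Γ.α k s)) (g k s) = 0}
  add_mem' {φ φ'} h h' := by
    obtain ⟨g, hg, hp⟩ := h
    obtain ⟨g', hg', hp'⟩ := h'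
    refine ⟨g + g', hg.add hg', fun k => ?_⟩
    filter_upwards [hp k, hp' k, Lp.coeFn_add (g k) (g' k)] with s h1 h2 h3
    rw [Pi.add_apply, h3, Pi.add_apply, map_add, h1, h2, add_zero]
  zero_mem' := by
    refine ⟨0, BoundaryParam.IsTrace.zero Γ, fun k => ?_⟩
    filter_upwards [Lp.coeFn_zero Spinor 2 (Γ.arcMeasure k)] with s hs
    rw [Pi.zero_apply, hs, Pi.zero_apply, map_zero]
  smul_mem' c φ h := by
    obtain ⟨g, hg, hp⟩ := h
    refine ⟨c • g, hg.smul c, fun k => ?_⟩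
    filter_upwards [hp k, Lp.coeFn_smul c (g k)] with s h1 h2
    rw [Pi.smul_apply, h2, Pi.smul_apply, map_smul, h1, smul_zero]

/-- The operator `H_∞ : D_∞ → L²(Ω, ℂ²)`, `H_∞ φ = T φ`. -/
def HInfty {Ω : Opens Plane} (Γ : BoundaryParam Ω) : domInfty Γ →ₗ[ℂ] L2 Ω :=
  diracT Ω ∘ₗ (domInfty Γ).subtype

end Graphene

end

open MeasureTheory Filter Topology TopologicalSpace
open scoped ContDiff

noncomputable section

namespace Graphene

/-! Write `J = iσ₃ = σ₁σ₂`. Expanding the square gives `|σ₁a + σ₂b|² = |a|² + |b|² + Re(⟨a, Jb⟩ -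
⟨b, Ja⟩)`, so the claim reduces to evaluating the cross term, `wedge` applied to the gradient of
`φ`. This form is a null Lagrangian: for smooth `w`, `v` the integrand is `∂₁⟨w, J∂₂v⟩ - ∂₂⟨w,
J∂₁v⟩`, and the divergence theorem turns it into the boundary integral of `⟨w, J∂ₛv⟩`
(`green_formula`).

On the boundary let `A(s)` be the matrix of the normal and `p` the restriction of a smooth `u`.
Since `AJ` is Hermitian and `A'J = -α'A`, the derivative of `Re⟨Ap, Jp⟩` is `2 Re⟨Ap, Jp'⟩ - α'
Re⟨Ap, p⟩`. Its integral over a closed curve vanishes, so the tangential derivative disappears: `Re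
∫⟨Ap, Jp'⟩ = ½ ∫ α' Re⟨Ap, p⟩` (`re_bdForm_normalMat`). If `Ap = p`, this is the curvature term.

Smooth approximations `uₙ` of `φ ∈ D_∞` need not satisfy the boundary condition. Instead `A` is
extended to a `C¹` matrix field `M` on the plane (`exists_contDiff_normal`), and `φ` is compared
with `Mφ`, which has the same trace. Against a fixed smooth function the boundary form sees only the
trace of its first argument, so `Mφ` and `φ` give the same form; by density this persists against
`φ`. The form of the pair `(Mφ, φ)` is the limit of the forms of `(Muₙ, uₙ)`, to which the boundary
computation applies exactly, and whose boundary values converge in `L²` (`re_wedge_eq`).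

The divergence theorem is proved by localization: a partition of unity reduces it to small balls,
inside `Ω` or in a graph chart. It also yields uniqueness of traces (`IsTrace.unique`), which
identifies the given trace with the one in the definition of `D_∞`. -/

/-! ### Integration by parts over the region above a graph -/

/-- Coordinates `(t, z) ↦ e⁻¹ (t, f t + z)` that flatten the graph of `f`. -/
def graphChart (e : Plane ≃ₗᵢ[ℝ] Plane) (f : ℝ → ℝ) (p : ℝ × ℝ) : Plane :=
  e.symm !₂[p.1, f p.1 + p.2]

theorem plane_eq (v : Plane) : v = !₂[v 0, v 1] := by
  ext i; fin_cases i <;> rfl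

theorem measurePreserving_toPlane :
    MeasurePreserving (fun p : ℝ × ℝ => (!₂[p.1, p.2] : Plane)) := by
  have h1 := (volume_preserving_finTwoArrow ℝ).symm
  have h2 := EuclideanSpace.volume_preserving_symm_measurableEquiv_toLp (Fin 2) |>.symm
  have h := h2.comp h1
  exact h

/-- The chart is a shear followed by an isometry, so no Jacobian appears; this uses only continuity
of `f`. -/
theorem measurePreserving_graphChart (e : Plane ≃ₗᵢ[ℝ] Plane) {f : ℝ → ℝ} (hf : Continuous f) :
    MeasurePreserving (graphChart e f) := by
  have h1 : MeasurePreserving (fun p : ℝ × ℝ => (p.1, f p.1 + p.2)) := by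
    refine (MeasurePreserving.id (volume : Measure ℝ)).skew_product (g := fun a c => f a + c)
      (by fun_prop) (Eventually.of_forall fun a => ?_)
    exact map_add_left_eq_self volume (f a)
  exact (e.symm.measurePreserving.comp measurePreserving_toPlane).comp h1

/-- `graphChart` as a homeomorphism. -/
def graphHomeo (e : Plane ≃ₗᵢ[ℝ] Plane) {f : ℝ → ℝ} (hf : Continuous f) : ℝ × ℝ ≃ₜ Plane where
  toFun := graphChart e f
  invFun x := (e x 0, e x 1 - f (e x 0))
  left_inv p := by simp [graphChart]
  right_inv x := by
    simp only [graphChart, add_sub_cancel]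
    rw [← plane_eq, e.symm_apply_apply]
  continuous_toFun := by
    unfold graphChart
    fun_prop
  continuous_invFun := by fun_prop

theorem hasDerivAt_toPlane (a b : ℝ) (t : ℝ) {y z : ℝ → ℝ} (hy : HasDerivAt y a t)
    (hz : HasDerivAt z b t) : HasDerivAt (fun t => (!₂[y t, z t] : Plane)) !₂[a, b] t := by
  have h : HasDerivAt (fun t => (![y t, z t] : Fin 2 → ℝ)) ![a, b] t := by
    rw [hasDerivAt_pi]
    intro i
    fin_cases i
    · exact hy
    · exact hz
  exact (EuclideanSpace.equiv (Fin 2) ℝ).symm.toContinuousLinearMap.hasFDerivAt.comp_hasDerivAt t h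

theorem hasDerivAt_graphChart_fst (e : Plane ≃ₗᵢ[ℝ] Plane) {f : ℝ → ℝ} (hf : ContDiff ℝ 1 f)
    (t z : ℝ) : HasDerivAt (fun t => graphChart e f (t, z)) (e.symm !₂[1, deriv f t]) t := by
  have h1 : HasDerivAt f (deriv f t) t := (hf.differentiable (by simp) t).hasDerivAt
  exact (e.symm.toContinuousLinearEquiv.toContinuousLinearMap.hasFDerivAt.comp_hasDerivAt t
    (hasDerivAt_toPlane _ _ t (hasDerivAt_id t) (h1.add_const z)))

theorem hasDerivAt_graphChart_snd (e : Plane ≃ₗᵢ[ℝ] Plane) (f : ℝ → ℝ)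
    (t z : ℝ) : HasDerivAt (fun z => graphChart e f (t, z)) (e.symm !₂[0, 1]) z :=
  (e.symm.toContinuousLinearEquiv.toContinuousLinearMap.hasFDerivAt.comp_hasDerivAt z
    (hasDerivAt_toPlane _ _ z (hasDerivAt_const z t) ((hasDerivAt_id z).const_add (f t))))

/-- In flattened coordinates the region becomes a half-plane. The component of `v` along the
translated graphs integrates to zero, and the vertical component leaves only the value on the graph.
-/
theorem setIntegral_fderiv_above_graph (e : Plane ≃ₗᵢ[ℝ] Plane) {f : ℝ → ℝ} (hf : ContDiff ℝ 1 f)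
    {G : Plane → ℂ} (hG : ContDiff ℝ 1 G) (hc : HasCompactSupport G) (v : Plane) :
    ∫ x in {x | f (e x 0) < e x 1}, fderiv ℝ G x v =
      ∫ t, (deriv f t * e v 0 - e v 1) • G (e.symm !₂[t, f t]) := by
  have hfc := hf.continuous
  have hf'c : Continuous (deriv f) := hf.continuous_deriv (by simp)
  set Ψ := graphHomeo e hfc with hΨ
  have hΨe : ∀ p, Ψ p = graphChart e f p := fun _ => rfl
  have hmp : MeasurePreserving Ψ := measurePreserving_graphChart e hfc
  have hpre : Ψ ⁻¹' {x | f (e x 0) < e x 1} = Set.univ ×ˢ Set.Ioi 0 := by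
    ext p
    simp [hΨe, graphChart]
  have hDG : Continuous (fun x => fderiv ℝ G x) := hG.continuous_fderiv (by simp)
  have hDGc : HasCompactSupport (fun x => fderiv ℝ G x) := hc.fderiv ℝ
  have hDΨ : HasCompactSupport (fun p => fderiv ℝ G (Ψ p)) := hDGc.comp_homeomorph Ψ
  have hGΨ : HasCompactSupport (fun p => G (Ψ p)) := hc.comp_homeomorph Ψ
  -- The two vectors are the `t`- and `z`-derivatives of the chart, so each part of `fderiv ℝ G x v`
  -- is a scalar multiple of a one-variable derivative. The coefficients depend on `t` alone, and
  -- the first one is constant.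
  have hv : ∀ t, v = e v 0 • e.symm !₂[1, deriv f t] +
      (e v 1 - deriv f t * e v 0) • e.symm !₂[0, 1] := by
    intro t
    rw [← map_smul, ← map_smul, ← map_add]
    apply e.injective
    rw [e.apply_symm_apply]
    ext i; fin_cases i
    · simp
    · simp; ring
  have hint : ∀ (c : ℝ → ℝ) (w : ℝ → Plane), Continuous c → Continuous w →
      Integrable (fun p : ℝ × ℝ => c p.1 • fderiv ℝ G (Ψ p) (w p.1)) := by
    intro c w hcc hw
    apply Continuous.integrable_of_hasCompactSupport
    · have := Ψ.continuous
      have h2 : Continuous fun p => fderiv ℝ G (Ψ p) := hDG.comp this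
      exact (hcc.comp continuous_fst).smul (h2.clm_apply (hw.comp continuous_fst))
    · refine hDΨ.mono ?_
      intro p hp h0
      apply hp
      simp only [h0]
      simp
  have hw1 : Continuous fun t => e.symm !₂[1, deriv f t] := by fun_prop
  have i1 := hint (fun _ => e v 0) (fun t => e.symm !₂[1, deriv f t]) continuous_const hw1
  have i2 := hint (fun t => e v 1 - deriv f t * e v 0) (fun t => e.symm !₂[0, 1])
    (by fun_prop) continuous_const
  have hGd : ∀ x, HasFDerivAt G (fderiv ℝ G x) x :=
    fun x => (hG.differentiable (by simp) x).hasFDerivAt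
  have hd1 : ∀ t z, HasDerivAt (fun t => G (Ψ (t, z)))
      (fderiv ℝ G (Ψ (t, z)) (e.symm !₂[1, deriv f t])) t := fun t z =>
    (hGd _).comp_hasDerivAt t (hasDerivAt_graphChart_fst e hf t z)
  have hd2 : ∀ t z, HasDerivAt (fun z => G (Ψ (t, z)))
      (fderiv ℝ G (Ψ (t, z)) (e.symm !₂[0, 1])) z := fun t z =>
    (hGd _).comp_hasDerivAt z (hasDerivAt_graphChart_snd e f t z)
  have hcs1 : ∀ z, HasCompactSupport (fun t => G (Ψ (t, z))) := by
    intro z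
    have : IsClosedEmbedding (fun t : ℝ => (t, z)) :=
      (Isometry.of_dist_eq fun a b => by simp [Prod.dist_eq]).isClosedEmbedding
    exact hGΨ.comp_isClosedEmbedding this
  have hcs2 : ∀ t, HasCompactSupport (fun z => G (Ψ (t, z))) := by
    intro t
    have : IsClosedEmbedding (fun z : ℝ => (t, z)) :=
      (Isometry.of_dist_eq fun a b => by simp [Prod.dist_eq]).isClosedEmbedding
    exact hGΨ.comp_isClosedEmbedding this
  rw [← hmp.setIntegral_preimage_emb Ψ.measurableEmbedding, hpre]
  have hsplit : ∀ p : ℝ × ℝ, fderiv ℝ G (Ψ p) v =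
      e v 0 • fderiv ℝ G (Ψ p) (e.symm !₂[1, deriv f p.1]) +
      (e v 1 - deriv f p.1 * e v 0) • fderiv ℝ G (Ψ p) (e.symm !₂[0, 1]) := by
    intro p
    conv_lhs => rw [hv p.1]
    rw [map_add, map_smul, map_smul]
  simp_rw [hsplit]
  rw [integral_add i1.integrableOn i2.integrableOn]
  -- Integrating in `t` first, the inner integral is that of the derivative of a compactly supported
  -- function.
  have e1 : ∫ p in Set.univ ×ˢ Set.Ioi (0:ℝ),
      e v 0 • fderiv ℝ G (Ψ p) (e.symm !₂[1, deriv f p.1]) = 0 := by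
    have := i1.integrableOn (s := Set.univ ×ˢ Set.Ioi (0:ℝ))
    rw [IntegrableOn, Measure.volume_eq_prod, ← Measure.prod_restrict] at this
    rw [Measure.volume_eq_prod, ← Measure.prod_restrict, integral_prod_symm _ this]
    apply integral_eq_zero_of_ae
    refine Eventually.of_forall fun z => ?_
    simp only [Measure.restrict_univ]
    rw [integral_smul]
    have : ∫ t, fderiv ℝ G (Ψ (t, z)) (e.symm !₂[1, deriv f t]) = 0 := by
      refine integral_eq_zero_of_hasDerivAt_of_integrable (hd1 · z) ?_ ?_
      · refine Continuous.integrable_of_hasCompactSupport ?_ ?_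
        · exact (hDG.comp (Ψ.continuous.comp (by fun_prop))).clm_apply hw1
        · have h := (hcs1 z).deriv
          rwa [show deriv (fun t => G (Ψ (t, z))) = _ from funext fun t => (hd1 t z).deriv] at h
      · exact Continuous.integrable_of_hasCompactSupport
          (hG.continuous.comp (Ψ.continuous.comp (by fun_prop))) (hcs1 z)
    rw [this]; simp
  have e2 : ∫ p in Set.univ ×ˢ Set.Ioi (0:ℝ),
      (e v 1 - deriv f p.1 * e v 0) • fderiv ℝ G (Ψ p) (e.symm !₂[0, 1]) =
      ∫ t, (deriv f t * e v 0 - e v 1) • G (e.symm !₂[t, f t]) := by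
    have := i2.integrableOn (s := Set.univ ×ˢ Set.Ioi (0:ℝ))
    rw [IntegrableOn, Measure.volume_eq_prod, ← Measure.prod_restrict] at this
    rw [Measure.volume_eq_prod, ← Measure.prod_restrict, integral_prod _ this, Measure.restrict_univ]
    refine integral_congr_ae (Eventually.of_forall fun t => ?_)
    simp only
    rw [integral_smul]
    have : ∫ z in Set.Ioi (0:ℝ), fderiv ℝ G (Ψ (t, z)) (e.symm !₂[0, 1]) =
        - G (e.symm !₂[t, f t]) := by
      have hC : ContDiff ℝ 1 (fun z => G (Ψ (t, z))) := by
        refine hG.comp (e.symm.contDiff.comp ?_)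
        rw [contDiff_euclidean]
        intro i
        fin_cases i
        · exact contDiff_const
        · exact (contDiff_const (c := f t)).add contDiff_id
      have h := (hcs2 t).integral_Ioi_deriv_eq hC 0
      simp_rw [(hd2 t _).deriv] at h
      rw [h, hΨe]
      simp [graphChart]
    rw [this, smul_neg, ← neg_smul, neg_sub]
  rw [e1, e2, zero_add]

/-! ### The boundary curves in a graph chart -/

/-- In the ball `B(x₀, r)` and the coordinates `e`, the set `Ω` lies above the graph of `f`. -/
def IsGraphIn (Ω : Opens Plane) (x₀ : Plane) (r : ℝ) (e : Plane ≃ₗᵢ[ℝ] Plane) (f : ℝ → ℝ) : Prop :=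
  ∀ x ∈ Metric.ball x₀ r, x ∈ Ω ↔ f (e x 0) < e x 1

/-- A point above the graph lies in the open set `Ω`; a point below it has a neighbourhood that
misses `Ω`. Neither can be a boundary point. -/
theorem IsGraphIn.eq_of_mem_frontier {Ω : Opens Plane} {x₀ : Plane} {r : ℝ}
    {e : Plane ≃ₗᵢ[ℝ] Plane} {f : ℝ → ℝ} (h : IsGraphIn Ω x₀ r e f) (hf : Continuous f)
    {x : Plane} (hx : x ∈ Metric.ball x₀ r) (hxf : x ∈ frontier (Ω : Set Plane)) :
    e x 1 = f (e x 0) := by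
  rw [Ω.isOpen.frontier_eq] at hxf
  have h1 : ¬ f (e x 0) < e x 1 := fun hlt => hxf.2 ((h x hx).2 hlt)
  refine le_antisymm (not_lt.1 h1) (not_lt.1 fun hlt => ?_)
  have hU : IsOpen ({y : Plane | e y 1 < f (e y 0)} ∩ Metric.ball x₀ r) :=
    (isOpen_lt (by fun_prop) (by fun_prop)).inter Metric.isOpen_ball
  obtain ⟨y, hy, hyΩ⟩ := mem_closure_iff.1 hxf.1 _ hU ⟨hlt, hx⟩
  exact lt_asymm hy.1 ((h y hy.2).1 hyΩ)

theorem inner_tangent_normal (e : Plane ≃ₗᵢ[ℝ] Plane) (θ : ℝ) :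
    e (tangentVec θ) 0 * e (normalVec θ) 0 + e (tangentVec θ) 1 * e (normalVec θ) 1 = 0 := by
  have h := e.inner_map_map (tangentVec θ) (normalVec θ)
  have h0 : inner ℝ (tangentVec θ) (normalVec θ) = 0 := by
    simp [tangentVec, normalVec, PiLp.inner_apply, Fin.sum_univ_two]
    ring
  rw [h0, PiLp.inner_apply, Fin.sum_univ_two] at h
  simp only [RCLike.inner_apply, conj_trivial] at h
  linarith

theorem sq_add_sq_map (e : Plane ≃ₗᵢ[ℝ] Plane) (v : Plane) :
    e v 0 ^ 2 + e v 1 ^ 2 = v 0 ^ 2 + v 1 ^ 2 := by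
  have h := e.norm_map v
  rw [EuclideanSpace.norm_eq, EuclideanSpace.norm_eq, Real.sqrt_inj (by positivity) (by positivity)]
    at h
  simpa [Fin.sum_univ_two] using h

variable {Ω : Opens Plane} (Γ : BoundaryParam Ω)

theorem BoundaryParam.mem_frontier (k : Fin Γ.N) (s : ℝ) : Γ.γ k s ∈ frontier (Ω : Set Plane) := by
  rw [← Γ.range_γ]
  exact Set.mem_iUnion_of_mem k ⟨s, rfl⟩

theorem BoundaryParam.exists_of_mem_frontier {x : Plane} (hx : x ∈ frontier (Ω : Set Plane)) :
    ∃ k s, Γ.γ k s = x := by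
  rw [← Γ.range_γ] at hx
  obtain ⟨k, s, hs⟩ := Set.mem_iUnion.1 hx
  exact ⟨k, s, hs⟩

theorem BoundaryParam.hasDerivAt_coord (e : Plane ≃ₗᵢ[ℝ] Plane) (k : Fin Γ.N) (s : ℝ) (i : Fin 2) :
    HasDerivAt (fun s => e (Γ.γ k s) i) (e (tangentVec (Γ.α k s)) i) s :=
  ((EuclideanSpace.proj i).comp
    e.toContinuousLinearEquiv.toContinuousLinearMap).hasFDerivAt.comp_hasDerivAt s (Γ.deriv_γ k s)

/-- Both parameters are moved into the fundamental interval, where injectivity applies. -/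
theorem BoundaryParam.eq_of_γ_eq {k l : Fin Γ.N} {s t : ℝ} (h : Γ.γ k s = Γ.γ l t) :
    k = l ∧ ∃ m : ℤ, s = t + m * Γ.L k := by
  have hk := Γ.L_pos k
  have hl := Γ.L_pos l
  have e1 := (Γ.periodic_γ k).sub_zsmul_eq (x := s) (toIcoDiv hk 0 s)
  have e2 := (Γ.periodic_γ l).sub_zsmul_eq (x := t) (toIcoDiv hl 0 t)
  have m1 := sub_toIcoDiv_zsmul_mem_Ico hk 0 s
  have m2 := sub_toIcoDiv_zsmul_mem_Ico hl 0 t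
  rw [zero_add] at m1 m2
  obtain ⟨rfl, h2⟩ := Γ.injective_γ k l _ m1 _ m2 (by rw [e1, e2, h])
  refine ⟨rfl, toIcoDiv hk 0 s - toIcoDiv hk 0 t, ?_⟩
  simp only [zsmul_eq_mul] at h2
  push_cast
  linarith

/-- The derivative of a periodic curve is periodic. The angle itself need not be: only its sine and
cosine are. -/
theorem BoundaryParam.periodic_tangentVec (k : Fin Γ.N) :
    Function.Periodic (fun s => tangentVec (Γ.α k s)) (Γ.L k) := by
  intro s
  have h1 := Γ.deriv_γ k (s + Γ.L k)
  have h2 : HasDerivAt (fun s => Γ.γ k (s + Γ.L k)) (tangentVec (Γ.α k (s + Γ.L k))) s :=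
    h1.comp_add_const s (Γ.L k)
  rw [show (fun s => Γ.γ k (s + Γ.L k)) = Γ.γ k from funext (Γ.periodic_γ k)] at h2
  exact h2.unique (Γ.deriv_γ k s)

theorem BoundaryParam.cos_sin_periodic (k : Fin Γ.N) (s : ℝ) :
    Real.cos (Γ.α k (s + Γ.L k)) = Real.cos (Γ.α k s) ∧
      Real.sin (Γ.α k (s + Γ.L k)) = Real.sin (Γ.α k s) := by
  have h := Γ.periodic_tangentVec k s
  constructor
  · simpa [tangentVec] using congrArg (fun v : Plane => v 1) h
  · simpa [tangentVec] using congrArg (fun v : Plane => v 0) h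

theorem BoundaryParam.periodic_normalVec (k : Fin Γ.N) :
    Function.Periodic (fun s => normalVec (Γ.α k s)) (Γ.L k) := by
  intro s
  simp only [normalVec, (Γ.cos_sin_periodic k s).1, (Γ.cos_sin_periodic k s).2]

/-- The tangent and the outward normal of the boundary in a graph chart. -/
theorem IsGraphIn.tangent_normal {x₀ : Plane} {r : ℝ} {e : Plane ≃ₗᵢ[ℝ] Plane} {f : ℝ → ℝ}
    (h : IsGraphIn Ω x₀ r e f) (hf : ContDiff ℝ 1 f) {k : Fin Γ.N} {s : ℝ}
    (hs : Γ.γ k s ∈ Metric.ball x₀ r) :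
    e (tangentVec (Γ.α k s)) 0 ^ 2 * (1 + deriv f (e (Γ.γ k s) 0) ^ 2) = 1 ∧
      e (normalVec (Γ.α k s)) 0 = |e (tangentVec (Γ.α k s)) 0| * deriv f (e (Γ.γ k s) 0) ∧
      e (normalVec (Γ.α k s)) 1 = -|e (tangentVec (Γ.α k s)) 0| := by
  set m := deriv f (e (Γ.γ k s) 0) with hm
  set n := normalVec (Γ.α k s) with hn
  set τ := tangentVec (Γ.α k s) with hτ
  have hfd : ∀ y, HasDerivAt f (deriv f y) y :=
    fun y => (hf.differentiable (by simp) y).hasDerivAt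
  -- Near `s` the curve stays on the graph, so its second coordinate is `f` of the first;
  -- differentiate this relation.
  have hz : e τ 1 = m * e τ 0 := by
    have h1 := Γ.hasDerivAt_coord e k s 1
    have h2 : HasDerivAt (fun s => f (e (Γ.γ k s) 0)) (m * e τ 0) s :=
      (hfd _).comp s (Γ.hasDerivAt_coord e k s 0)
    refine h1.unique (h2.congr_of_eventuallyEq ?_)
    have : ∀ᶠ t in 𝓝 s, Γ.γ k t ∈ Metric.ball x₀ r :=
      (Γ.contDiff_γ k).continuous.continuousAt.eventually (Metric.isOpen_ball.mem_nhds hs)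
    filter_upwards [this] with t ht
    exact h.eq_of_mem_frontier hf.continuous ht (Γ.mem_frontier k t)
  have hτ1 : e τ 0 ^ 2 + e τ 1 ^ 2 = 1 := by
    rw [sq_add_sq_map]
    simp [hτ, tangentVec]
  have hn1 : e n 0 ^ 2 + e n 1 ^ 2 = 1 := by
    rw [sq_add_sq_map]
    simp [hn, normalVec]
  have horth : e τ 0 * e n 0 + e τ 1 * e n 1 = 0 := inner_tangent_normal e _
  have ha : e τ 0 ^ 2 * (1 + m ^ 2) = 1 := by rw [hz] at hτ1; linarith
  have hne : e τ 0 ≠ 0 := fun h0 => by simp [h0] at ha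
  have hp : e n 0 = -m * e n 1 := by
    apply mul_left_cancel₀ hne
    rw [hz] at horth
    linarith
  have hq2 : e n 1 ^ 2 * (1 + m ^ 2) = 1 := by rw [hp] at hn1; linarith
  have hq : e n 1 ≤ 0 := by
    by_contra! hpos
    -- the function `t ↦ z(γ - t n) - f(y(γ - t n))` would decrease from `0`
    have hd : HasDerivAt (fun t : ℝ => e (Γ.γ k s - t • n) 1 - f (e (Γ.γ k s - t • n) 0))
        (-e n 1 - m * (-e n 0)) 0 := by
      have hc : ∀ i, HasDerivAt (fun t : ℝ => e (Γ.γ k s - t • n) i) (-e n i) 0 := by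
        intro i
        have : HasDerivAt (fun t : ℝ => e (Γ.γ k s) i - t * e n i) (-(1 * e n i)) 0 :=
          ((hasDerivAt_id (0 : ℝ)).mul_const (e n i)).const_sub _
        simpa using this
      refine (hc 1).sub ?_
      have := hfd (e (Γ.γ k s - (0 : ℝ) • n) 0)
      have h2 := this.comp (0 : ℝ) (hc 0)
      simpa [hm, Function.comp_def] using h2
    have hneg : -e n 1 - m * (-e n 0) < 0 := by
      rw [hp]; nlinarith [mul_nonneg hpos.le (sq_nonneg m)]
    have hlim := hd.tendsto_slope_zero_right
    have hev := hlim.eventually (gt_mem_nhds hneg)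
    have hball : ∀ᶠ t : ℝ in 𝓝[>] 0, Γ.γ k s - t • n ∈ Metric.ball x₀ r := by
      have hcont : ContinuousAt (fun t : ℝ => Γ.γ k s - t • n) 0 := by fun_prop
      refine (hcont.eventually (Metric.isOpen_ball.mem_nhds ?_)).filter_mono nhdsWithin_le_nhds
      simpa using hs
    obtain ⟨t, ht1, ht2, ht3, ht4⟩ :=
      (hev.and ((Γ.outward k s).and (hball.and self_mem_nhdsWithin))).exists
    have hgt := (h _ ht3).1 ht2.1
    have h0 := h.eq_of_mem_frontier hf.continuous hs (Γ.mem_frontier k s)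
    have htpos : 0 < t := ht4
    simp only [zero_add, zero_smul, sub_zero, h0, sub_self, smul_eq_mul] at ht1
    have := mul_pos (inv_pos.2 htpos) (sub_pos.2 hgt)
    linarith
  -- Tangent and normal are orthogonal unit vectors, so `|e τ 0| = |e n 1|`; the sign just found
  -- removes the second absolute value.
  have habs : |e τ 0| = -e n 1 := by
    have hpos : 0 < 1 + m ^ 2 := by positivity
    have : e τ 0 ^ 2 = e n 1 ^ 2 := mul_right_cancel₀ hpos.ne' (ha.trans hq2.symm)
    rw [sq_eq_sq_iff_abs_eq_abs] at this
    rw [this, abs_of_nonpos hq]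
  refine ⟨ha, ?_, ?_⟩
  · rw [habs, hp]; ring
  · rw [habs]; ring

/-- The outward normal of the region above the graph of `f`. -/
def graphNormal (e : Plane ≃ₗᵢ[ℝ] Plane) (f : ℝ → ℝ) (x : Plane) : Plane :=
  (Real.sqrt (1 + deriv f (e x 0) ^ 2))⁻¹ • e.symm !₂[deriv f (e x 0), -1]

theorem contDiff_graphNormal (e : Plane ≃ₗᵢ[ℝ] Plane) {f : ℝ → ℝ} (hf : ContDiff ℝ 3 f) :
    ContDiff ℝ 1 (graphNormal e f) := by
  have h1 : ContDiff ℝ 1 (deriv f) := by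
    have : ContDiff ℝ (2 + 1) f := hf
    exact ((contDiff_succ_iff_deriv.1 this).2.2).of_le (by norm_num)
  have h2 : ContDiff ℝ 1 (fun x : Plane => deriv f (e x 0)) := by
    refine h1.comp ?_
    exact ((EuclideanSpace.proj (𝕜 := ℝ) (0 : Fin 2)).contDiff).comp e.contDiff
  refine ContDiff.smul (ContDiff.inv (ContDiff.sqrt (by fun_prop) fun x => by positivity)
    fun x => by positivity) (e.symm.contDiff.comp ?_)
  rw [contDiff_euclidean]
  intro i
  fin_cases i
  · exact h2
  · exact contDiff_const

theorem IsGraphIn.graphNormal_eq {x₀ : Plane} {r : ℝ} {e : Plane ≃ₗᵢ[ℝ] Plane} {f : ℝ → ℝ}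
    (h : IsGraphIn Ω x₀ r e f) (hf : ContDiff ℝ 1 f) {k : Fin Γ.N} {s : ℝ}
    (hs : Γ.γ k s ∈ Metric.ball x₀ r) : graphNormal e f (Γ.γ k s) = normalVec (Γ.α k s) := by
  obtain ⟨h1, h2, h3⟩ := h.tangent_normal Γ hf hs
  have habs : (Real.sqrt (1 + deriv f (e (Γ.γ k s) 0) ^ 2))⁻¹ = |e (tangentVec (Γ.α k s)) 0| := by
    rw [← Real.sqrt_inv, ← eq_inv_of_mul_eq_one_left h1, Real.sqrt_sq_eq_abs]
  apply e.injective
  rw [graphNormal, habs, map_smul, e.apply_symm_apply, plane_eq (e (normalVec _)), h2, h3]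
  ext i; fin_cases i <;> simp

/-- The outward normal extends to a `C¹` vector field on the plane. -/
theorem BoundaryParam.exists_contDiff_normal (hC3 : HasC3Boundary Ω) :
    ∃ ν : Plane → Plane, ContDiff ℝ 1 ν ∧ ∀ k s, ν (Γ.γ k s) = normalVec (Γ.α k s) := by
  obtain ⟨ν, hν⟩ := exists_contMDiffMap_forall_mem_convex_of_local (n := 1) (F := Plane)
    (modelWithCornersSelf ℝ Plane)
    -- The condition is void off the boundary and prescribes one vector on it, so it is stable under
    -- convex combinations, and local extensions can be glued.
    (t := fun x => {v : Plane | ∀ k s, Γ.γ k s = x → v = normalVec (Γ.α k s)}) (by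
      intro x v hv w hw a b _ _ hab k s hs
      rw [hv k s hs, hw k s hs, ← add_smul, hab, one_smul]) (by
      intro x₀
      by_cases hx : x₀ ∈ frontier (Ω : Set Plane)
      · obtain ⟨r, hr, e, f, hf, h⟩ := hC3 x₀ hx
        refine ⟨Metric.ball x₀ r, Metric.ball_mem_nhds x₀ hr, graphNormal e f,
          (contDiff_graphNormal e hf).contMDiff.contMDiffOn, ?_⟩
        rintro y hy k s rfl
        exact IsGraphIn.graphNormal_eq Γ h (hf.of_le (by norm_num)) hy
      · refine ⟨(frontier (Ω : Set Plane))ᶜ, isClosed_frontier.isOpen_compl.mem_nhds hx, 0,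
          contMDiffOn_const, ?_⟩
        rintro y hy k s rfl
        exact absurd (Γ.mem_frontier k s) hy)
  exact ⟨ν, ν.contMDiff.contDiff, fun k s => hν _ k s rfl⟩

/-! ### The divergence theorem in `Ω` -/

/-- The component `⟨n, v⟩` of the outward normal at angle `θ`. -/
def normalComp (θ : ℝ) (v : Plane) : ℝ := Real.cos θ * v 0 + Real.sin θ * v 1

theorem normalComp_eq (e : Plane ≃ₗᵢ[ℝ] Plane) (θ : ℝ) (v : Plane) :
    normalComp θ v = e (normalVec θ) 0 * e v 0 + e (normalVec θ) 1 * e v 1 := by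
  have h := e.inner_map_map (normalVec θ) v
  rw [PiLp.inner_apply, PiLp.inner_apply, Fin.sum_univ_two, Fin.sum_univ_two] at h
  simp only [RCLike.inner_apply, conj_trivial] at h
  simp only [normalVec, normalComp] at h ⊢
  simp at h
  linarith

/-- The integral of `⟨n, v⟩ G` over the boundary. -/
def BoundaryParam.flux (G : Plane → ℂ) (v : Plane) : ℂ :=
  ∑ k, ∫ s in (0 : ℝ)..Γ.L k, normalComp (Γ.α k s) v • G (Γ.γ k s)

theorem BoundaryParam.flux_eq_zero {G : Plane → ℂ} (hG : ∀ k s, G (Γ.γ k s) = 0) (v : Plane) :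
    Γ.flux G v = 0 := by
  simp [BoundaryParam.flux, hG]

/-- This exchanges `Ω` for the region above a graph, which agrees with it only near the support of
the integrand. -/
theorem setIntegral_congr_of_support {E : Type*} [NormedAddCommGroup E] [NormedSpace ℝ E]
    {A B U : Set Plane} (hA : MeasurableSet A) (hB : MeasurableSet B) {F : Plane → E}
    (hF : ∀ x ∉ U, F x = 0) (hAB : ∀ x ∈ U, x ∈ A ↔ x ∈ B) :
    ∫ x in A, F x = ∫ x in B, F x := by
  rw [← integral_indicator hA, ← integral_indicator hB]
  congr 1
  ext x
  by_cases hx : x ∈ U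
  · by_cases hxA : x ∈ A
    · rw [Set.indicator_of_mem hxA, Set.indicator_of_mem ((hAB x hx).1 hxA)]
    · rw [Set.indicator_of_notMem hxA, Set.indicator_of_notMem fun h => hxA ((hAB x hx).2 h)]
  · simp [Set.indicator, hF x hx]

theorem fderiv_eq_zero_of_notMem {G : Plane → ℂ} {U : Set Plane} (hG : tsupport G ⊆ U)
    (v : Plane) : ∀ x ∉ U, fderiv ℝ G x v = 0 := by
  intro x hx
  have h : x ∉ tsupport (fderiv ℝ G) := fun h => hx (hG (tsupport_fderiv_subset ℝ h))
  rw [image_eq_zero_of_notMem_tsupport h]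
  simp

theorem measurableSet_above_graph (e : Plane ≃ₗᵢ[ℝ] Plane) {f : ℝ → ℝ} (hf : Continuous f) :
    MeasurableSet {x : Plane | f (e x 0) < e x 1} :=
  (isOpen_lt (by fun_prop) (by fun_prop)).measurableSet

theorem hasCompactSupport_of_tsupport_subset_ball {G : Plane → ℂ} {x₀ : Plane} {r : ℝ}
    (h : tsupport G ⊆ Metric.ball x₀ r) : HasCompactSupport G :=
  Metric.isCompact_of_isClosed_isBounded (isClosed_tsupport G) (Metric.isBounded_ball.subset h)

theorem divergence_theorem_interior {x₀ : Plane} {r : ℝ} (hr : Metric.ball x₀ r ⊆ (Ω : Set Plane))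
    {G : Plane → ℂ} (hG : ContDiff ℝ 1 G) (hs : tsupport G ⊆ Metric.ball x₀ r) (v : Plane) :
    ∫ x in (Ω : Set Plane), fderiv ℝ G x v = Γ.flux G v := by
  have hc := hasCompactSupport_of_tsupport_subset_ball hs
  have h0 : ∀ x ∉ Metric.ball x₀ r, G x = 0 := fun x hx =>
    image_eq_zero_of_notMem_tsupport fun h => hx (hs h)
  rw [Γ.flux_eq_zero]
  · have h1 := setIntegral_fderiv_above_graph (LinearIsometryEquiv.refl ℝ Plane)
      (f := fun _ => x₀ 1 - r) contDiff_const hG hc v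
    have hm := measurableSet_above_graph (LinearIsometryEquiv.refl ℝ Plane)
      (f := fun _ => x₀ 1 - r) continuous_const
    rw [setIntegral_congr_of_support Ω.isOpen.measurableSet hm (fderiv_eq_zero_of_notMem hs v), h1]
    · apply integral_eq_zero_of_ae
      refine Eventually.of_forall fun t => ?_
      simp only
      rw [h0, smul_zero]; rfl
      intro hb
      rw [Metric.mem_ball, dist_eq_norm] at hb
      have := (PiLp.norm_apply_le (_ - x₀) 1).trans_lt hb
      change |(x₀ 1 - r) - x₀ 1| < r at this
      rw [sub_sub_cancel_left, abs_neg] at this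
      exact absurd this (not_lt.2 (le_abs_self r))
    · intro x hx
      refine iff_of_true (hr hx) ?_
      rw [Metric.mem_ball, dist_eq_norm] at hx
      have := (PiLp.norm_apply_le (x - x₀) 1).trans_lt hx
      rw [Real.norm_eq_abs, abs_lt] at this
      simp at this ⊢
      linarith
  · intro k s
    apply h0
    intro hx
    have := Γ.mem_frontier k s
    rw [Ω.isOpen.frontier_eq] at this
    exact this.2 (hr hx)

/-- By periodicity the integration interval may start at `s₀ - δ`. It then contains the arc, and
within one period no other translate of the arc contributes. -/
theorem BoundaryParam.flux_eq_arc {k : Fin Γ.N} {s₀ δ : ℝ} (hδ : 0 < δ) (hδL : 2 * δ < Γ.L k)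
    {G : Plane → ℂ} (hG : ∀ l t, G (Γ.γ l t) ≠ 0 →
      l = k ∧ ∃ m : ℤ, t + m * Γ.L k ∈ Set.Ioo (s₀ - δ) (s₀ + δ)) (v : Plane) :
    Γ.flux G v = ∫ s in Set.Ioo (s₀ - δ) (s₀ + δ), normalComp (Γ.α k s) v • G (Γ.γ k s) := by
  rw [BoundaryParam.flux, Finset.sum_eq_single k]
  · have hp : Function.Periodic (fun s => normalComp (Γ.α k s) v • G (Γ.γ k s)) (Γ.L k) := by
      intro s
      simp only [normalComp, (Γ.cos_sin_periodic k s).1, (Γ.cos_sin_periodic k s).2,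
        Γ.periodic_γ k s]
    have h1 := hp.intervalIntegral_add_eq 0 (s₀ - δ)
    rw [zero_add] at h1
    rw [h1, intervalIntegral.integral_of_le (by linarith [Γ.L_pos k]),
      ← integral_indicator measurableSet_Ioc, ← integral_indicator measurableSet_Ioo]
    congr 1
    ext s
    by_cases hI : s ∈ Set.Ioo (s₀ - δ) (s₀ + δ)
    · have hJ : s ∈ Set.Ioc (s₀ - δ) (s₀ - δ + Γ.L k) := ⟨hI.1, by linarith [hI.2]⟩
      rw [Set.indicator_of_mem hI, Set.indicator_of_mem hJ]
    · rw [Set.indicator_of_notMem hI]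
      by_cases hJ : s ∈ Set.Ioc (s₀ - δ) (s₀ - δ + Γ.L k)
      · rw [Set.indicator_of_mem hJ]
        by_cases h0 : G (Γ.γ k s) = 0
        · rw [h0, smul_zero]
        · obtain ⟨-, m, hm⟩ := hG k s h0
          exfalso
          have hL := Γ.L_pos k
          have hm1 : m < 1 := by
            by_contra! h
            have : (1 : ℝ) ≤ m := by exact_mod_cast h
            nlinarith [hm.2, hJ.1]
          have hm2 : -1 < m := by
            by_contra! h
            have : (m : ℝ) ≤ -1 := by exact_mod_cast h
            nlinarith [hm.1, hJ.2]
          obtain rfl : m = 0 := by omega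
          apply hI
          simpa using hm
      · rw [Set.indicator_of_notMem hJ]
  · intro l _ hl
    have : ∀ s, G (Γ.γ l s) = 0 := by
      intro s
      by_contra h0
      exact hl (hG l s h0).1
    simp [this]
  · simp

theorem exists_divergence_theorem_boundary {x₀ : Plane} {r : ℝ} (hr : 0 < r)
    (hx₀ : x₀ ∈ frontier (Ω : Set Plane)) {e : Plane ≃ₗᵢ[ℝ] Plane} {f : ℝ → ℝ}
    (hf : ContDiff ℝ 1 f) (h : IsGraphIn Ω x₀ r e f) :
    ∃ ρ > 0, ∀ G : Plane → ℂ, ContDiff ℝ 1 G → tsupport G ⊆ Metric.ball x₀ ρ → ∀ v,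
      ∫ x in (Ω : Set Plane), fderiv ℝ G x v = Γ.flux G v := by
  obtain ⟨k, s₀, rfl⟩ := Γ.exists_of_mem_frontier hx₀
  set y : ℝ → ℝ := fun s => e (Γ.γ k s) 0 with hy
  have hyd : ∀ s, HasDerivAt y (e (tangentVec (Γ.α k s)) 0) s :=
    fun s => Γ.hasDerivAt_coord e k s 0
  have hyC : ContDiff ℝ 1 y := by
    have h1 : ContDiff ℝ 1 (Γ.γ k) := (Γ.contDiff_γ k).of_le (by norm_num)
    exact ((EuclideanSpace.proj (𝕜 := ℝ) (0 : Fin 2)).contDiff).comp (e.contDiff.comp h1)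
  -- a short arc around `s₀`
  obtain ⟨δ, hδ, hδL, hδr⟩ : ∃ δ > 0, 2 * δ < Γ.L k ∧
      ∀ s ∈ Set.Ioo (s₀ - δ) (s₀ + δ), Γ.γ k s ∈ Metric.ball (Γ.γ k s₀) r := by
    have hc := (Γ.contDiff_γ k).continuous.continuousAt.eventually
      (Metric.ball_mem_nhds (Γ.γ k s₀) hr)
    obtain ⟨d, hd, hd'⟩ := Metric.eventually_nhds_iff.1 hc
    have hL := Γ.L_pos k
    refine ⟨min d (Γ.L k / 4), by positivity, ?_, ?_⟩
    · linarith [min_le_right d (Γ.L k / 4)]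
    · intro s hs
      apply hd'
      rw [Real.dist_eq, abs_lt]
      constructor <;> linarith [hs.1, hs.2, min_le_left d (Γ.L k / 4)]
  set S := Set.Ioo (s₀ - δ) (s₀ + δ) with hS
  have hs₀ : s₀ ∈ S := ⟨by linarith, by linarith⟩
  have hgraph : ∀ {x}, x ∈ Metric.ball (Γ.γ k s₀) r → x ∈ frontier (Ω : Set Plane) →
      x = e.symm !₂[e x 0, f (e x 0)] := by
    intro x hx hxf
    rw [← h.eq_of_mem_frontier hf.continuous hx hxf, ← plane_eq, e.symm_apply_apply]
  -- In the chart the first coordinate determines a boundary point, and a boundary point determines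
  -- the parameter up to whole periods.
  have hinj : Set.InjOn y S := by
    intro s hs t ht hst
    have h1 := hgraph (hδr s hs) (Γ.mem_frontier k s)
    have h2 := hgraph (hδr t ht) (Γ.mem_frontier k t)
    have h3 : Γ.γ k s = Γ.γ k t := by
      rw [h1, h2]
      change e.symm !₂[y s, f (y s)] = e.symm !₂[y t, f (y t)]
      rw [hst]
    obtain ⟨-, m, hm⟩ := Γ.eq_of_γ_eq h3
    have hL := Γ.L_pos k
    have hm1 : m < 1 := by
      by_contra! h
      have : (1 : ℝ) ≤ m := by exact_mod_cast h
      nlinarith [hs.1, hs.2, ht.1, ht.2]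
    have hm2 : -1 < m := by
      by_contra! h
      have : (m : ℝ) ≤ -1 := by exact_mod_cast h
      nlinarith [hs.1, hs.2, ht.1, ht.2]
    obtain rfl : m = 0 := by omega
    simpa using hm
  have himg : y '' S ∈ 𝓝 (y s₀) := by
    have hne : e (tangentVec (Γ.α k s₀)) 0 ≠ 0 := by
      intro h0
      have := (h.tangent_normal Γ hf (hδr s₀ hs₀)).1
      simp [h0] at this
    have hst : HasStrictDerivAt y (e (tangentVec (Γ.α k s₀)) 0) s₀ :=
      hyC.contDiffAt.hasStrictDerivAt' (hyd s₀) (by simp)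
    rw [← hst.map_nhds_eq hne]
    exact image_mem_map (isOpen_Ioo.mem_nhds hs₀)
  obtain ⟨ρ', hρ', hρimg⟩ := Metric.mem_nhds_iff.1 himg
  have hcoord : ∀ (i : Fin 2) (x : Plane), dist (e x i) (e (Γ.γ k s₀) i) ≤ dist x (Γ.γ k s₀) := by
    intro i x
    have := PiLp.norm_apply_le (e (x - Γ.γ k s₀)) i
    rw [e.norm_map, map_sub] at this
    rw [dist_eq_norm, dist_eq_norm]
    exact this
  -- Every point of the small ball projects onto the image of the arc. Hence no other arc, of this
  -- curve or another, can meet the ball.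
  have hcov : ∀ x ∈ Metric.ball (Γ.γ k s₀) (min ρ' r), e x 0 ∈ y '' S := by
    intro x hx
    apply hρimg
    rw [Metric.mem_ball] at hx ⊢
    exact (hcoord 0 x).trans_lt (hx.trans_le (min_le_left _ _))
  refine ⟨min ρ' r, by positivity, fun G hG hs v => ?_⟩
  have h0 : ∀ x, G x ≠ 0 → x ∈ Metric.ball (Γ.γ k s₀) (min ρ' r) :=
    fun x hx => hs (subset_tsupport _ hx)
  rw [Γ.flux_eq_arc (s₀ := s₀) hδ hδL]
  -- Replace `Ω` by the region above the graph, then substitute `t = y s` in the graph integral. The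
  -- factor `|y' s|` turns `(f', -1)` into the outward unit normal.
  · rw [setIntegral_congr_of_support Ω.isOpen.measurableSet
      (measurableSet_above_graph e hf.continuous) (fderiv_eq_zero_of_notMem hs v)
      (fun x hx => h x (Metric.ball_subset_ball (min_le_right _ _) hx)),
      setIntegral_fderiv_above_graph e hf hG (hasCompactSupport_of_tsupport_subset_ball hs) v,
      ← setIntegral_eq_integral_of_forall_compl_eq_zero (s := y '' S),
      integral_image_eq_integral_abs_deriv_smul measurableSet_Ioo
        (fun s _ => (hyd s).hasDerivWithinAt) hinj]
    · refine setIntegral_congr_fun measurableSet_Ioo fun s hsS => ?_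
      obtain ⟨-, h2, h3⟩ := h.tangent_normal Γ hf (hδr s hsS)
      have h4 : e.symm !₂[y s, f (y s)] = Γ.γ k s := (hgraph (hδr s hsS) (Γ.mem_frontier k s)).symm
      simp only [h4]
      rw [normalComp_eq e, h2, h3, smul_smul]
      congr 1
      ring
    · intro t ht
      by_cases hGt : G (e.symm !₂[t, f t]) = 0
      · rw [hGt, smul_zero]
      · exact absurd (by simpa using hcov _ (h0 _ hGt)) ht
  · intro l t hGt
    have hx := h0 _ hGt
    obtain ⟨s, hsS, hst⟩ := hcov _ hx
    have h1 := hgraph (hδr s hsS) (Γ.mem_frontier k s)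
    have h2 := hgraph (Metric.ball_subset_ball (min_le_right _ _) hx) (Γ.mem_frontier l t)
    have h3 : Γ.γ k s = Γ.γ l t := by
      rw [h1, h2, ← hst]
    obtain ⟨rfl, m, hm⟩ := Γ.eq_of_γ_eq h3
    exact ⟨rfl, m, hm ▸ hsS⟩

theorem exists_local_divergence_theorem (hC3 : HasC3Boundary Ω) {x₀ : Plane}
    (hx₀ : x₀ ∈ closure (Ω : Set Plane)) :
    ∃ ρ > 0, ∀ G : Plane → ℂ, ContDiff ℝ 1 G → tsupport G ⊆ Metric.ball x₀ ρ → ∀ v,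
      ∫ x in (Ω : Set Plane), fderiv ℝ G x v = Γ.flux G v := by
  by_cases hx : x₀ ∈ (Ω : Set Plane)
  · obtain ⟨r, hr, hb⟩ := Metric.isOpen_iff.1 Ω.isOpen x₀ hx
    exact ⟨r, hr, fun G hG hs v => divergence_theorem_interior Γ hb hG hs v⟩
  · have hf : x₀ ∈ frontier (Ω : Set Plane) := by
      rw [Ω.isOpen.frontier_eq]; exact ⟨hx₀, hx⟩
    obtain ⟨r, hr, e, f, hf3, h⟩ := hC3 x₀ hf
    exact exists_divergence_theorem_boundary Γ hr hf (hf3.of_le (by norm_num)) h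

theorem integrableOn_of_continuous {E : Type*} [NormedAddCommGroup E]
    (hbdd : Bornology.IsBounded (Ω : Set Plane)) {F : Plane → E} (hF : Continuous F) :
    IntegrableOn F (Ω : Set Plane) :=
  (hF.continuousOn.integrableOn_compact hbdd.isCompact_closure).mono_set subset_closure

theorem BoundaryParam.continuous_normalComp (k : Fin Γ.N) (v : Plane) :
    Continuous fun s => normalComp (Γ.α k s) v := by
  have := Γ.continuous_α k
  unfold normalComp
  fun_prop

/-- The divergence theorem for `C¹` functions. -/
theorem divergence_theorem (hbdd : Bornology.IsBounded (Ω : Set Plane)) (hC3 : HasC3Boundary Ω)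
    {G : Plane → ℂ} (hG : ContDiff ℝ 1 G) (v : Plane) :
    ∫ x in (Ω : Set Plane), fderiv ℝ G x v = Γ.flux G v := by
  choose! ρ hρ hloc using fun x₀ (hx : x₀ ∈ closure (Ω : Set Plane)) =>
    exists_local_divergence_theorem Γ hC3 hx
  have hK : IsCompact (closure (Ω : Set Plane)) := hbdd.isCompact_closure
  obtain ⟨T, hT⟩ := hK.elim_nhds_subcover' (fun x _ => Metric.ball x (ρ x))
    fun x hx => Metric.ball_mem_nhds x (hρ x hx)
  obtain ⟨χ, hχ⟩ := SmoothPartitionOfUnity.exists_isSubordinate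
    (modelWithCornersSelf ℝ Plane) isClosed_closure
    (fun i : T => Metric.ball (i.1 : Plane) (ρ i.1)) (fun _ => Metric.isOpen_ball) (by
      intro x hx
      obtain ⟨i, hi, hxi⟩ := Set.mem_iUnion₂.1 (hT hx)
      exact Set.mem_iUnion.2 ⟨⟨i, hi⟩, hxi⟩)
  have hχC : ∀ i, ContDiff ℝ 1 (χ i) := fun i =>
    ((χ i).contMDiff.contDiff).of_le (by exact_mod_cast le_top)
  have hχG : ∀ i, ContDiff ℝ 1 (fun x => χ i x • G x) := fun i => (hχC i).smul hG
  have hsum : ∀ x ∈ closure (Ω : Set Plane), G x = ∑ i, χ i x • G x := by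
    intro x hx
    rw [← Finset.sum_smul]
    have := χ.sum_eq_one hx
    rw [finsum_eq_sum_of_fintype] at this
    rw [this, one_smul]
  have h1 : ∀ i, ∫ x in (Ω : Set Plane), fderiv ℝ (fun x => χ i x • G x) x v =
      Γ.flux (fun x => χ i x • G x) v := by
    intro i
    refine hloc i.1 i.1.2 _ (hχG i) ?_ v
    exact (closure_mono (Function.support_smul_subset_left _ _)).trans (hχ i)
  have h2 : ∫ x in (Ω : Set Plane), fderiv ℝ G x v =
      ∑ i, ∫ x in (Ω : Set Plane), fderiv ℝ (fun x => χ i x • G x) x v := by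
    rw [← integral_finsetSum]
    -- The partition of unity sums to one on the closure, hence near each point of the open set `Ω`,
    -- so the decomposition may be differentiated there.
    · refine setIntegral_congr_fun Ω.isOpen.measurableSet fun x hx => ?_
      have hev : G =ᶠ[𝓝 x] fun x => ∑ i, χ i x • G x := by
        filter_upwards [Ω.isOpen.mem_nhds hx] with z hz
        exact hsum z (subset_closure hz)
      rw [hev.fderiv_eq, fderiv_fun_sum fun i _ => (hχG i).differentiable (by simp) x]
      simp
    · intro i _
      exact integrableOn_of_continuous hbdd
        (((hχG i).continuous_fderiv (by simp)).clm_apply continuous_const)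
  have h3 : Γ.flux G v = ∑ i, Γ.flux (fun x => χ i x • G x) v := by
    simp only [BoundaryParam.flux]
    rw [Finset.sum_comm]
    refine Finset.sum_congr rfl fun k _ => ?_
    rw [← intervalIntegral.integral_finsetSum]
    · refine intervalIntegral.integral_congr fun s _ => ?_
      rw [← Finset.smul_sum, ← hsum _ (frontier_subset_closure (Γ.mem_frontier k s))]
    · intro i _
      exact ((Γ.continuous_normalComp k v).smul
        ((hχG i).continuous.comp (Γ.contDiff_γ k).continuous)).intervalIntegrable _ _
  rw [h2, h3]
  exact Finset.sum_congr rfl fun i _ => h1 i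

/-! ### Convergence in `L²` -/

/-- `u n → f` in `L²(μ)`, for functions. -/
structure L2Tendsto {X : Type*} [MeasurableSpace X] (μ : Measure X) (u : ℕ → X → Spinor)
    (f : X → Spinor) : Prop where
  memLp : ∀ n, MemLp (u n) 2 μ
  memLp_lim : MemLp f 2 μ
  tendsto : Tendsto (fun n => eLpNorm (fun x => u n x - f x) 2 μ) atTop (𝓝 0)

section

variable {X : Type*} [MeasurableSpace X] {μ : Measure X}

theorem integrable_inner_of_memLp {f h : X → Spinor} (hf : MemLp f 2 μ) (hh : MemLp h 2 μ) :
    Integrable (fun x => inner ℂ (f x) (h x)) μ := by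
  refine (L2.integrable_inner (𝕜 := ℂ) (hf.toLp f) (hh.toLp h)).congr ?_
  filter_upwards [hf.coeFn_toLp, hh.coeFn_toLp] with x h1 h2
  rw [h1, h2]

theorem inner_toLp {f h : X → Spinor} (hf : MemLp f 2 μ) (hh : MemLp h 2 μ) :
    inner ℂ (hf.toLp f) (hh.toLp h) = ∫ x, inner ℂ (f x) (h x) ∂μ := by
  rw [L2.inner_def]
  apply integral_congr_ae
  filter_upwards [hf.coeFn_toLp, hh.coeFn_toLp] with x h1 h2
  rw [h1, h2]

theorem L2Tendsto.const {f : X → Spinor} (hf : MemLp f 2 μ) : L2Tendsto μ (fun _ => f) f :=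
  ⟨fun _ => hf, hf, by simp⟩

theorem L2Tendsto.inner {u v : ℕ → X → Spinor} {f h : X → Spinor} (hu : L2Tendsto μ u f)
    (hv : L2Tendsto μ v h) :
    Tendsto (fun n => ∫ x, inner ℂ (u n x) (v n x) ∂μ) atTop (𝓝 (∫ x, inner ℂ (f x) (h x) ∂μ)) := by
  simp_rw [← inner_toLp (hu.memLp _) (hv.memLp _), ← inner_toLp hu.memLp_lim hv.memLp_lim]
  refine Tendsto.inner ?_ ?_
  · exact (Lp.tendsto_Lp_iff_tendsto_eLpNorm'' _ hu.memLp _ hu.memLp_lim).2 hu.tendsto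
  · exact (Lp.tendsto_Lp_iff_tendsto_eLpNorm'' _ hv.memLp _ hv.memLp_lim).2 hv.tendsto

theorem L2Tendsto.add {u v : ℕ → X → Spinor} {f h : X → Spinor} (hu : L2Tendsto μ u f)
    (hv : L2Tendsto μ v h) :
    L2Tendsto μ (fun n x => u n x + v n x) (fun x => f x + h x) :=
  ⟨fun n => (hu.memLp n).add (hv.memLp n), hu.memLp_lim.add hv.memLp_lim,
    tendsto_eLpNorm_add (fun n => (hu.memLp n).1) (fun n => (hv.memLp n).1) hu.memLp_lim.1
      hv.memLp_lim.1 (EventuallyEq.refl _ _) hu.tendsto hv.tendsto⟩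

theorem memLp_field_apply {B : X → Spinor →L[ℂ] Spinor} (hB : AEStronglyMeasurable B μ) {C : ℝ}
    (hC : ∀ᵐ x ∂μ, ‖B x‖ ≤ C) {f : X → Spinor} (hf : MemLp f 2 μ) :
    MemLp (fun x => B x (f x)) 2 μ := by
  refine hf.of_le_mul (c := C) ?_ ?_
  · exact (isBoundedBilinearMap_apply (𝕜 := ℂ)).continuous.comp_aestronglyMeasurable
      (hB.prodMk hf.1)
  · filter_upwards [hC] with x hx
    exact (B x).le_of_opNorm_le hx _

theorem L2Tendsto.field {B : X → Spinor →L[ℂ] Spinor} (hB : AEStronglyMeasurable B μ) {C : ℝ}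
    (hC : ∀ᵐ x ∂μ, ‖B x‖ ≤ C) {u : ℕ → X → Spinor} {f : X → Spinor} (hu : L2Tendsto μ u f) :
    L2Tendsto μ (fun n x => B x (u n x)) (fun x => B x (f x)) := by
  refine ⟨fun n => memLp_field_apply hB hC (hu.memLp n), memLp_field_apply hB hC hu.memLp_lim, ?_⟩
  have h := ENNReal.Tendsto.const_mul (a := ENNReal.ofReal C) hu.tendsto (Or.inr ENNReal.ofReal_ne_top)
  rw [mul_zero] at h
  refine tendsto_of_tendsto_of_tendsto_of_le_of_le tendsto_const_nhds h (fun n => zero_le)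
    (fun n => ?_)
  refine eLpNorm_le_mul_eLpNorm_of_ae_le_mul ?_ 2
  filter_upwards [hC] with x hx
  rw [← map_sub]
  exact (B x).le_of_opNorm_le hx _

theorem L2Tendsto.clm (B : Spinor →L[ℂ] Spinor) {u : ℕ → X → Spinor} {f : X → Spinor}
    (hu : L2Tendsto μ u f) : L2Tendsto μ (fun n x => B (u n x)) (fun x => B (f x)) :=
  hu.field (B := fun _ => B) aestronglyMeasurable_const (C := ‖B‖) (by simp)

theorem L2Tendsto.unique {u : ℕ → X → Spinor} {f h : X → Spinor} (hu : L2Tendsto μ u f)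
    (hv : L2Tendsto μ u h) : f =ᵐ[μ] h := by
  have h1 := (Lp.tendsto_Lp_iff_tendsto_eLpNorm'' _ hu.memLp _ hu.memLp_lim).2 hu.tendsto
  have h2 := (Lp.tendsto_Lp_iff_tendsto_eLpNorm'' _ hv.memLp _ hv.memLp_lim).2 hv.tendsto
  exact (MemLp.toLp_eq_toLp_iff _ _).1 (tendsto_nhds_unique h1 h2)

end

/-! ### Pointwise algebra -/

/-- The matrix `i σ₃`. -/
def iSigma3 : Spinor →L[ℂ] Spinor := matAct !![Complex.I, 0; 0, -Complex.I]

/-- The matrix `A` of a normal vector `v`, namely `v₁ σ₂ - v₂ σ₁`. -/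
def normalMat (v : Plane) : Spinor →L[ℂ] Spinor :=
  v 0 • matAct (pauli 1) - v 1 • matAct (pauli 0)

theorem iSigma3_apply (u : Spinor) : iSigma3 u = !₂[Complex.I * u 0, -Complex.I * u 1] := by
  ext i
  fin_cases i <;> simp [iSigma3, Matrix.ofLp_toEuclideanCLM, Matrix.mulVec, dotProduct]

theorem pauli_zero_apply (u : Spinor) : matAct (pauli 0) u = !₂[u 1, u 0] := by
  ext i
  fin_cases i <;> simp [pauli, Matrix.ofLp_toEuclideanCLM, Matrix.mulVec, dotProduct]

theorem pauli_one_apply (u : Spinor) :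
    matAct (pauli 1) u = !₂[-Complex.I * u 1, Complex.I * u 0] := by
  ext i
  fin_cases i <;> simp [pauli, Matrix.ofLp_toEuclideanCLM, Matrix.mulVec, dotProduct]

theorem normalMat_apply (v : Plane) (u : Spinor) :
    normalMat v u = !₂[(-(v 0) * Complex.I - v 1) * u 1, (v 0 * Complex.I - v 1) * u 0] := by
  simp only [normalMat, _root_.sub_apply, _root_.smul_apply,
    pauli_zero_apply, pauli_one_apply]
  ext i
  fin_cases i <;> simp <;> ring

/-- This rests on `i e^{iθ} = -sin θ + i cos θ`. -/
theorem matAct_bdMatrix (θ : ℝ) : matAct (bdMatrix θ) = normalMat (normalVec θ) := by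
  ext u i
  rw [normalMat_apply]
  have h : Complex.exp (Complex.I * θ) = Complex.cos θ + Complex.sin θ * Complex.I := by
    rw [mul_comm, Complex.exp_mul_I]
  fin_cases i
  · simp [bdMatrix, Matrix.ofLp_toEuclideanCLM, Matrix.mulVec, dotProduct, normalVec, h,
      ← Complex.cos_conj, ← Complex.sin_conj]
    linear_combination (Complex.sin θ * u 1) * Complex.I_mul_I
  · simp [bdMatrix, Matrix.ofLp_toEuclideanCLM, Matrix.mulVec, dotProduct, normalVec, h]
    left
    linear_combination (Complex.sin θ) * Complex.I_mul_I

theorem matAct_bdMatrix_of_projMinus {θ : ℝ} {u : Spinor} (h : matAct (projMinus θ) u = 0) :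
    normalMat (normalVec θ) u = u := by
  rw [← matAct_bdMatrix]
  rw [projMinus, matAct, map_smul, map_sub, map_one] at h
  simp only [_root_.smul_apply, _root_.sub_apply,
    one_apply_eq_self, smul_eq_zero] at h
  rcases h with h | h
  · norm_num at h
  · exact (sub_eq_zero.1 h).symm

/-- The Pauli matrices are Hermitian with square one, and `σ₁σ₂ = -σ₂σ₁ = iσ₃` gives the cross
terms. -/
theorem norm_sq_dirac (a b : Spinor) :
    ‖(1 / Complex.I) • (matAct (pauli 0) a + matAct (pauli 1) b)‖ ^ 2 =
      ‖a‖ ^ 2 + ‖b‖ ^ 2 + (inner ℂ a (iSigma3 b) - inner ℂ b (iSigma3 a)).re := by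
  rw [norm_smul, pauli_zero_apply, pauli_one_apply, iSigma3_apply, iSigma3_apply]
  simp only [EuclideanSpace.norm_sq_eq, mul_pow, Fin.sum_univ_two, PiLp.inner_apply,
    Complex.sq_norm, Complex.normSq_apply]
  simp
  ring

/-- `normalMat v` is Hermitian, `iσ₃` is anti-Hermitian, and the two anticommute, so their product
is Hermitian. -/
theorem inner_normalMat_left (v : Plane) (a b : Spinor) :
    (inner ℂ (normalMat v a) (iSigma3 b)).re = (inner ℂ (normalMat v b) (iSigma3 a)).re := by
  simp only [normalMat_apply, iSigma3_apply, PiLp.inner_apply, Fin.sum_univ_two]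
  simp
  ring

/-- The matrix of the tangent times `iσ₃` is minus the matrix of the normal. This identity produces
the curvature term. -/
theorem inner_normalMat_tangentVec (θ : ℝ) (a : Spinor) :
    (inner ℂ (normalMat (tangentVec θ) a) (iSigma3 a)).re =
      -(inner ℂ (normalMat (normalVec θ) a) a).re := by
  simp only [normalMat_apply, iSigma3_apply, PiLp.inner_apply, Fin.sum_univ_two, tangentVec,
    normalVec]
  simp
  ring

theorem contDiff_normalMat {ν : Plane → Plane} (hν : ContDiff ℝ 1 ν) :
    ContDiff ℝ 1 (fun x => normalMat (ν x)) := by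
  rw [contDiff_euclidean] at hν
  exact ((hν 0).smul contDiff_const).sub ((hν 1).smul contDiff_const)

theorem hasDerivAt_normalMat {α : ℝ → ℝ} {α' s : ℝ} (hα : HasDerivAt α α' s) :
    HasDerivAt (fun s => normalMat (normalVec (α s))) (α' • normalMat (tangentVec (α s))) s := by
  have h1 := (hα.cos.smul_const (matAct (pauli 1))).sub (hα.sin.smul_const (matAct (pauli 0)))
  have h2 : α' • normalMat (tangentVec (α s)) = (-Real.sin (α s) * α') • matAct (pauli 1) -
      (Real.cos (α s) * α') • matAct (pauli 0) := by
    rw [normalMat, smul_sub, smul_smul, smul_smul, mul_comm, mul_comm α']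
    rfl
  rw [h2]
  exact h1

/-! ### Regularity of the turning angle -/

theorem BoundaryParam.contDiff_cos_sin (k : Fin Γ.N) :
    ContDiff ℝ 1 (fun s => Real.cos (Γ.α k s)) ∧ ContDiff ℝ 1 (fun s => Real.sin (Γ.α k s)) := by
  have h1 : ContDiff ℝ 1 (fun s => tangentVec (Γ.α k s)) := by
    rw [← show deriv (Γ.γ k) = _ from funext fun s => (Γ.deriv_γ k s).deriv]
    have : ContDiff ℝ (2 + 1) (Γ.γ k) := Γ.contDiff_γ k
    exact ((contDiff_succ_iff_deriv.1 this).2.2).of_le (by norm_num)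
  rw [contDiff_euclidean] at h1
  refine ⟨by simpa [tangentVec] using h1 1, by simpa [tangentVec] using (h1 0).neg⟩

/-- Only continuity of the angle is given, but its sine and cosine are components of `γ'`. Near `s₀`
the angle is recovered as `α(s₀) + arcsin(sin(α - α(s₀)))`. -/
theorem BoundaryParam.contDiff_α (k : Fin Γ.N) : ContDiff ℝ 1 (Γ.α k) := by
  rw [contDiff_iff_contDiffAt]
  intro s₀
  obtain ⟨hc, hs⟩ := Γ.contDiff_cos_sin k
  have hd : ContDiff ℝ 1 (fun s => Real.sin (Γ.α k s - Γ.α k s₀)) := by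
    simp only [Real.sin_sub]
    exact (hs.mul contDiff_const).sub (hc.mul contDiff_const)
  have hA : ContDiffAt ℝ 1 (fun s => Γ.α k s₀ + Real.arcsin (Real.sin (Γ.α k s - Γ.α k s₀))) s₀ := by
    have h1 : ContDiffAt ℝ 1 Real.arcsin (Real.sin (Γ.α k s₀ - Γ.α k s₀)) := by
      apply Real.contDiffAt_arcsin <;> simp
    have h2 := ContDiffAt.comp (g := Real.arcsin) s₀ h1 hd.contDiffAt
    exact contDiffAt_const.add h2
  refine hA.congr_of_eventuallyEq ?_
  have hev : ∀ᶠ s in 𝓝 s₀, Γ.α k s - Γ.α k s₀ ∈ Set.Ioo (-(Real.pi / 2)) (Real.pi / 2) := by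
    have hcont : ContinuousAt (fun s => Γ.α k s - Γ.α k s₀) s₀ :=
      ((Γ.continuous_α k).sub continuous_const).continuousAt
    refine hcont.eventually (isOpen_Ioo.mem_nhds ?_)
    simp [Real.pi_pos]
  filter_upwards [hev] with s hs
  rw [Real.arcsin_sin hs.1.le hs.2.le]
  ring

theorem BoundaryParam.hasDerivAt_α (k : Fin Γ.N) (s : ℝ) :
    HasDerivAt (Γ.α k) (deriv (Γ.α k) s) s :=
  ((Γ.contDiff_α k).differentiable (by simp) s).hasDerivAt

theorem BoundaryParam.continuous_deriv_α (k : Fin Γ.N) : Continuous (deriv (Γ.α k)) :=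
  (Γ.contDiff_α k).continuous_deriv (by simp)

theorem BoundaryParam.continuous_tangentVec (k : Fin Γ.N) :
    Continuous fun s => tangentVec (Γ.α k s) := by
  have := Γ.continuous_α k
  unfold tangentVec
  fun_prop

/-! ### Green's formula -/

/-- The boundary form `∫ ⟨w, i σ₃ ∂ₛ v⟩ ds`. -/
def BoundaryParam.bdForm (w v : Plane → Spinor) : ℂ :=
  ∑ k, ∫ s, inner ℂ (w (Γ.γ k s)) (iSigma3 (fderiv ℝ v (Γ.γ k s) (tangentVec (Γ.α k s))))
    ∂Γ.arcMeasure k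

/-- The form `∫ ⟨a₁, i σ₃ b₂⟩ - ⟨a₂, i σ₃ b₁⟩` over `Ω`. -/
def wedge (Ω : Opens Plane) (a b : Fin 2 → Plane → Spinor) : ℂ :=
  (∫ x in (Ω : Set Plane), inner ℂ (a 0 x) (iSigma3 (b 1 x))) -
    ∫ x in (Ω : Set Plane), inner ℂ (a 1 x) (iSigma3 (b 0 x))

/-- The classical partial derivatives. -/
def grad (u : Plane → Spinor) (j : Fin 2) (x : Plane) : Spinor := fderiv ℝ u x (basisVec j)

theorem continuous_grad {u : Plane → Spinor} (hu : ContDiff ℝ 1 u) (j : Fin 2) :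
    Continuous (grad u j) :=
  (hu.continuous_fderiv (by simp)).clm_apply continuous_const

theorem fderiv_tangentVec (v : Plane → Spinor) (x : Plane) (θ : ℝ) :
    fderiv ℝ v x (tangentVec θ) = Real.cos θ • grad v 1 x - Real.sin θ • grad v 0 x := by
  have h : tangentVec θ = Real.cos θ • basisVec 1 - Real.sin θ • basisVec 0 := by
    ext i
    fin_cases i <;> simp [tangentVec]
  rw [h, map_sub, map_smul, map_smul]
  rfl

/-- The integrand is a divergence, because the mixed second derivatives of `v` cancel. Only first
derivatives of `w` occur; this matters because the formula is applied to `w = Mu` with `M` merely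
`C¹`. -/
theorem green_formula (hbdd : Bornology.IsBounded (Ω : Set Plane)) (hC3 : HasC3Boundary Ω)
    {w v : Plane → Spinor} (hw : ContDiff ℝ 1 w) (hv : ContDiff ℝ 2 v) :
    wedge Ω (grad w) (grad v) = Γ.bdForm w v := by
  have hv1 : ContDiff ℝ 1 v := hv.of_le (by norm_num)
  have hg : ∀ j, ContDiff ℝ 1 (grad v j) := fun j =>
    (hv.fderiv_right (m := 1) (by norm_num)).clm_apply contDiff_const
  have hJ : ∀ j, ContDiff ℝ 1 (fun x => iSigma3 (grad v j x)) := fun j =>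
    (iSigma3.restrictScalars ℝ).contDiff.comp (hg j)
  have hG : ∀ j, ContDiff ℝ 1 (fun x => inner ℂ (w x) (iSigma3 (grad v j x))) := fun j =>
    hw.inner ℂ (hJ j)
  have hd : ∀ i j x, fderiv ℝ (fun x => inner ℂ (w x) (iSigma3 (grad v j x))) x (basisVec i) =
      inner ℂ (w x) (iSigma3 (fderiv ℝ (fderiv ℝ v) x (basisVec i) (basisVec j))) +
        inner ℂ (grad w i x) (iSigma3 (grad v j x)) := by
    intro i j x
    rw [fderiv_inner_apply ℂ (hw.differentiable (by simp) x) ((hJ j).differentiable (by simp) x)]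
    congr 2
    have h1 : HasFDerivAt (fderiv ℝ v) (fderiv ℝ (fderiv ℝ v) x) x :=
      ((hv.fderiv_right (m := 1) (by norm_num)).differentiable (by simp) x).hasFDerivAt
    have h2 := (iSigma3.restrictScalars ℝ).hasFDerivAt.comp x
      (h1.clm_apply (hasFDerivAt_const (basisVec j) x))
    have h3 : HasFDerivAt (fun x => iSigma3 (grad v j x)) _ x := h2
    rw [h3.fderiv]
    simp
  have hsymm : ∀ x, fderiv ℝ (fderiv ℝ v) x (basisVec 0) (basisVec 1) =
      fderiv ℝ (fderiv ℝ v) x (basisVec 1) (basisVec 0) := fun x =>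
    (hv.contDiffAt.isSymmSndFDerivAt (by simp)) _ _
  have hint : ∀ i j, IntegrableOn (fun x => inner ℂ (grad w i x) (iSigma3 (grad v j x)))
      (Ω : Set Plane) := fun i j => integrableOn_of_continuous hbdd
    ((continuous_grad hw i).inner (hJ j).continuous)
  have hint2 : ∀ i j, IntegrableOn
      (fun x => fderiv ℝ (fun x => inner ℂ (w x) (iSigma3 (grad v j x))) x (basisVec i))
      (Ω : Set Plane) := fun i j => integrableOn_of_continuous hbdd
    (((hG j).continuous_fderiv (by simp)).clm_apply continuous_const)
  have h0 := divergence_theorem Γ hbdd hC3 (hG 1) (basisVec 0)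
  have h1 := divergence_theorem Γ hbdd hC3 (hG 0) (basisVec 1)
  have e1 : wedge Ω (grad w) (grad v) =
      Γ.flux (fun x => inner ℂ (w x) (iSigma3 (grad v 1 x))) (basisVec 0) -
        Γ.flux (fun x => inner ℂ (w x) (iSigma3 (grad v 0 x))) (basisVec 1) := by
    rw [← h0, ← h1, wedge, ← integral_sub (hint 0 1) (hint 1 0),
      ← integral_sub (hint2 0 1) (hint2 1 0)]
    refine integral_congr_ae (Eventually.of_forall fun x => ?_)
    simp only [hd, hsymm]
    ring
  rw [e1, BoundaryParam.flux, BoundaryParam.flux, BoundaryParam.bdForm, ← Finset.sum_sub_distrib]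
  refine Finset.sum_congr rfl fun k _ => ?_
  have hcont : ∀ (j i : Fin 2), Continuous fun s => normalComp (Γ.α k s) (basisVec i) •
      (inner ℂ (w (Γ.γ k s)) (iSigma3 (grad v j (Γ.γ k s))) : ℂ) := fun j i =>
    (Γ.continuous_normalComp k _).smul ((hG j).continuous.comp (Γ.contDiff_γ k).continuous)
  rw [← intervalIntegral.integral_sub ((hcont 1 0).intervalIntegrable _ _)
    ((hcont 0 1).intervalIntegrable _ _), intervalIntegral.integral_of_le (Γ.L_pos k).le]
  refine integral_congr_ae (Eventually.of_forall fun s => ?_)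
  simp only [fderiv_tangentVec, normalComp]
  rw [map_sub, inner_sub_right, iSigma3.map_smul_of_tower, iSigma3.map_smul_of_tower, inner_smul_right_eq_smul,
    inner_smul_right_eq_smul]
  simp

/-- The real part of the boundary form for the symmetrized trace. -/
theorem re_bdForm_normalMat {ν : Plane → Plane} (hν : ∀ k s, ν (Γ.γ k s) = normalVec (Γ.α k s))
    {u : Plane → Spinor} (hu : ContDiff ℝ 2 u) :
    (Γ.bdForm (fun x => normalMat (ν x) (u x)) u).re = 1 / 2 * ∑ k, (∫ s,
      inner ℂ (normalMat (normalVec (Γ.α k s)) (u (Γ.γ k s)))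
        (deriv (Γ.α k) s • u (Γ.γ k s)) ∂Γ.arcMeasure k).re := by
  rw [BoundaryParam.bdForm, Complex.re_sum, Finset.mul_sum]
  refine Finset.sum_congr rfl fun k _ => ?_
  simp only [hν]
  have hu1 : ContDiff ℝ 1 u := hu.of_le (by norm_num)
  have hγc := (Γ.contDiff_γ k).continuous
  have hαc := Γ.continuous_α k
  have hα'c := Γ.continuous_deriv_α k
  set p : ℝ → Spinor := fun s => u (Γ.γ k s) with hp
  set p' : ℝ → Spinor := fun s => fderiv ℝ u (Γ.γ k s) (tangentVec (Γ.α k s)) with hp'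
  have hpd : ∀ s, HasDerivAt p (p' s) s := fun s =>
    (hu1.differentiable (by simp) _).hasFDerivAt.comp_hasDerivAt s (Γ.deriv_γ k s)
  have hpc : Continuous p := hu1.continuous.comp hγc
  have hp'c : Continuous p' :=
    ((hu1.continuous_fderiv (by simp)).comp hγc).clm_apply (Γ.continuous_tangentVec k)
  set M : ℝ → Spinor →L[ℂ] Spinor := fun s => normalMat (normalVec (Γ.α k s)) with hM
  have hMd : ∀ s, HasDerivAt M (deriv (Γ.α k) s • normalMat (tangentVec (Γ.α k s))) s :=
    fun s => hasDerivAt_normalMat (Γ.hasDerivAt_α k s)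
  have hMc : Continuous M := continuous_iff_continuousAt.2 fun s => (hMd s).continuousAt
  have hMpd : ∀ s, HasDerivAt (fun s => M s (p s))
      (deriv (Γ.α k) s • normalMat (tangentVec (Γ.α k s)) (p s) + M s (p' s)) s := by
    intro s
    have h1 : HasDerivAt (fun s => (M s).restrictScalars ℝ)
      ((deriv (Γ.α k) s • normalMat (tangentVec (Γ.α k s))).restrictScalars ℝ) s :=
      (ContinuousLinearMap.restrictScalarsL ℂ Spinor Spinor ℝ ℝ).hasFDerivAt.comp_hasDerivAt s
        (hMd s)
    exact h1.clm_apply (hpd s)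
  have hJpd : ∀ s, HasDerivAt (fun s => iSigma3 (p s)) (iSigma3 (p' s)) s := fun s =>
    (iSigma3.restrictScalars ℝ).hasFDerivAt.comp_hasDerivAt s (hpd s)
  have hMpc : Continuous fun s => M s (p s) := hMc.clm_apply hpc
  -- In the product rule the two terms containing `p'` have equal real parts, and the term
  -- containing `M'` equals `-α' Re⟨Mp, p⟩`.
  have hFd : ∀ s, HasDerivAt (fun s => (inner ℂ (M s (p s)) (iSigma3 (p s))).re)
      (2 * (inner ℂ (M s (p s)) (iSigma3 (p' s))).re -
        (inner ℂ (M s (p s)) (deriv (Γ.α k) s • p s)).re) s := by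
    intro s
    have h1 := Complex.reCLM.hasFDerivAt.comp_hasDerivAt s ((hMpd s).inner ℂ (hJpd s))
    refine HasDerivAt.congr_deriv h1 ?_
    simp only [Complex.reCLM_apply, Complex.add_re, inner_add_left]
    rw [inner_normalMat_left _ (p' s) (p s), inner_smul_left_eq_smul, inner_smul_right_eq_smul,
      Complex.smul_re, Complex.smul_re, inner_normalMat_tangentVec]
    simp only [hM, smul_eq_mul]
    ring
  have hc1 : Continuous fun s => (inner ℂ (M s (p s)) (iSigma3 (p' s)) : ℂ) :=
    hMpc.inner (iSigma3.continuous.comp hp'c)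
  have hc2 : Continuous fun s => (inner ℂ (M s (p s)) (deriv (Γ.α k) s • p s) : ℂ) :=
    hMpc.inner (hα'c.smul hpc)
  have hr1 : Continuous fun s => 2 * (inner ℂ (M s (p s)) (iSigma3 (p' s)) : ℂ).re :=
    continuous_const.mul (Complex.continuous_re.comp hc1)
  have hr2 : Continuous fun s => (inner ℂ (M s (p s)) (deriv (Γ.α k) s • p s) : ℂ).re :=
    Complex.continuous_re.comp hc2
  have hFTC := intervalIntegral.integral_eq_sub_of_hasDerivAt (a := 0) (b := Γ.L k)
    (fun s _ => hFd s) ((hr1.sub hr2).intervalIntegrable _ _)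
  -- The boundary terms cancel because `M` depends on the angle only through the normal, which is
  -- periodic.
  have hper : M (Γ.L k) = M 0 ∧ p (Γ.L k) = p 0 := by
    have h1 := Γ.periodic_normalVec k 0
    have h2 := Γ.periodic_γ k 0
    simp only [zero_add] at h1 h2
    exact ⟨by simp only [hM, h1], by simp only [hp, h2]⟩
  rw [hper.1, hper.2, sub_self, intervalIntegral.integral_sub
    (hr1.intervalIntegrable _ _) (hr2.intervalIntegrable _ _),
    intervalIntegral.integral_const_mul, intervalIntegral.integral_of_le (Γ.L_pos k).le,
    intervalIntegral.integral_of_le (Γ.L_pos k).le] at hFTC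
  have hre : ∀ {F : ℝ → ℂ}, Continuous F →
      (∫ s, F s ∂Γ.arcMeasure k).re = ∫ s, (F s).re ∂Γ.arcMeasure k := by
    intro F hF
    have : Integrable F (Γ.arcMeasure k) :=
      (hF.integrableOn_Icc (a := 0) (b := Γ.L k)).mono_set Set.Ioc_subset_Icc_self
    exact (integral_re this).symm
  rw [hre hc1, hre hc2]
  linarith

/-! ### Smooth approximations and uniqueness of the trace -/

theorem L2Tendsto.congr_lim {X : Type*} [MeasurableSpace X] {μ : Measure X} {u : ℕ → X → Spinor}
    {f h : X → Spinor} (hu : L2Tendsto μ u f) (hfh : f =ᵐ[μ] h) : L2Tendsto μ u h := by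
  refine ⟨hu.memLp, hu.memLp_lim.ae_eq hfh, hu.tendsto.congr fun n => eLpNorm_congr_ae ?_⟩
  filter_upwards [hfh] with x hx
  rw [hx]

theorem memLp_of_continuous (hbdd : Bornology.IsBounded (Ω : Set Plane)) {f : Plane → Spinor}
    (hf : Continuous f) : MemLp f 2 (volume.restrict (Ω : Set Plane)) := by
  rw [memLp_two_iff_integrable_sq_norm hf.aestronglyMeasurable]
  exact integrableOn_of_continuous hbdd (hf.norm.pow 2)

theorem BoundaryParam.integrable_arc {E : Type*} [NormedAddCommGroup E] (k : Fin Γ.N) {f : ℝ → E}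
    (hf : Continuous f) : Integrable f (Γ.arcMeasure k) :=
  (hf.integrableOn_Icc (a := 0) (b := Γ.L k)).mono_set Set.Ioc_subset_Icc_self

theorem BoundaryParam.memLp_arc (k : Fin Γ.N) {f : ℝ → Spinor} (hf : Continuous f) :
    MemLp f 2 (Γ.arcMeasure k) := by
  rw [memLp_two_iff_integrable_sq_norm hf.aestronglyMeasurable]
  exact Γ.integrable_arc k (hf.norm.pow 2)

theorem L2Tendsto.continuous_field (hbdd : Bornology.IsBounded (Ω : Set Plane))
    {B : Plane → Spinor →L[ℂ] Spinor} (hB : Continuous B) {u : ℕ → Plane → Spinor}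
    {f : Plane → Spinor} (hu : L2Tendsto (volume.restrict (Ω : Set Plane)) u f) :
    L2Tendsto (volume.restrict (Ω : Set Plane)) (fun n x => B x (u n x)) (fun x => B x (f x)) := by
  obtain ⟨C, hC⟩ := hbdd.isCompact_closure.exists_bound_of_continuousOn hB.continuousOn
  refine hu.field hB.aestronglyMeasurable (C := C) ?_
  filter_upwards [ae_restrict_mem Ω.isOpen.measurableSet] with x hx
  exact hC x (subset_closure hx)

theorem L2Tendsto.continuous_field_arc {k : Fin Γ.N}
    {B : ℝ → Spinor →L[ℂ] Spinor} (hB : Continuous B) {u : ℕ → ℝ → Spinor}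
    {f : ℝ → Spinor} (hu : L2Tendsto (Γ.arcMeasure k) u f) :
    L2Tendsto (Γ.arcMeasure k) (fun n x => B x (u n x)) (fun x => B x (f x)) := by
  obtain ⟨C, hC⟩ := (isCompact_Icc (a := 0) (b := Γ.L k)).exists_bound_of_continuousOn
    hB.continuousOn
  refine hu.field hB.aestronglyMeasurable (C := C) ?_
  filter_upwards [ae_restrict_mem measurableSet_Ioc] with x hx
  exact hC x (Set.Ioc_subset_Icc_self hx)

theorem BoundaryParam.IsTrace.exists_approx {Γ : BoundaryParam Ω}
    (hbdd : Bornology.IsBounded (Ω : Set Plane)) {φ : sobolevH1 Ω} {g : Γ.L2Boundary}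
    (h : Γ.IsTrace φ g) : ∃ u : ℕ → Plane → Spinor, (∀ n, ContDiff ℝ ∞ (u n)) ∧
      L2Tendsto (volume.restrict (Ω : Set Plane)) u (φ : L2 Ω) ∧
      (∀ j, L2Tendsto (volume.restrict (Ω : Set Plane)) (fun n => grad (u n) j)
        (weakPartial Ω j φ)) ∧
      ∀ k, L2Tendsto (Γ.arcMeasure k) (fun n s => u n (Γ.γ k s)) (g k) := by
  obtain ⟨u, hu, h0, h1, h2⟩ := h
  exact ⟨u, hu, ⟨fun n => memLp_of_continuous hbdd (hu n).continuous, Lp.memLp _, h0⟩,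
    fun j => ⟨fun n => memLp_of_continuous hbdd
      (continuous_grad ((hu n).of_le (by exact_mod_cast le_top)) j), Lp.memLp _, h1 j⟩,
    fun k => ⟨fun n => Γ.memLp_arc k ((hu n).continuous.comp (Γ.contDiff_γ k).continuous),
      Lp.memLp _, h2 k⟩⟩

/-- The boundary `L²` norm as an integral over `Ω`. -/
theorem sum_boundary_norm_sq (hbdd : Bornology.IsBounded (Ω : Set Plane)) (hC3 : HasC3Boundary Ω)
    {ν : Plane → Plane} (hν1 : ContDiff ℝ 1 ν) (hν : ∀ k s, ν (Γ.γ k s) = normalVec (Γ.α k s))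
    {w : Plane → Spinor} (hw : ContDiff ℝ 1 w) :
    ∑ k, ∫ s, inner ℂ (w (Γ.γ k s)) (w (Γ.γ k s)) ∂Γ.arcMeasure k =
      ∑ j : Fin 2, ((∫ x in (Ω : Set Plane), inner ℂ (grad w j x) (ν x j • w x)) +
        (∫ x in (Ω : Set Plane), inner ℂ (ν x j • w x) (grad w j x)) +
        ∫ x in (Ω : Set Plane), inner ℂ (w x) (fderiv ℝ (fun x => ν x j) x (basisVec j) • w x)) := by
  have hνj : ∀ j, ContDiff ℝ 1 (fun x => ν x j) := contDiff_euclidean.1 hν1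
  have hνw : ∀ j, ContDiff ℝ 1 (fun x => ν x j • w x) := fun j => (hνj j).smul hw
  have hG : ∀ j, ContDiff ℝ 1 (fun x => inner ℂ (w x) (ν x j • w x)) := fun j =>
    hw.inner ℂ (hνw j)
  have hd : ∀ (j : Fin 2) x, fderiv ℝ (fun x => inner ℂ (w x) (ν x j • w x)) x (basisVec j) =
      inner ℂ (grad w j x) (ν x j • w x) + inner ℂ (ν x j • w x) (grad w j x) +
        inner ℂ (w x) (fderiv ℝ (fun x => ν x j) x (basisVec j) • w x) := by
    intro j x
    rw [fderiv_inner_apply ℂ (hw.differentiable (by simp) x) ((hνw j).differentiable (by simp) x),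
      fderiv_fun_smul ((hνj j).differentiable (by simp) x) (hw.differentiable (by simp) x)]
    simp only [_root_.add_apply, _root_.smul_apply, ContinuousLinearMap.smulRight_apply,
      inner_add_right, inner_smul_right_eq_smul, inner_smul_left_eq_smul, grad]
    ring
  -- The divergence theorem for the field `|w|² ν`: its normal component on the boundary is `|w|²`,
  -- since `ν` is the unit normal there.
  have hflux : ∀ j : Fin 2, Γ.flux (fun x => inner ℂ (w x) (ν x j • w x)) (basisVec j) =
      (∫ x in (Ω : Set Plane), inner ℂ (grad w j x) (ν x j • w x)) +
        (∫ x in (Ω : Set Plane), inner ℂ (ν x j • w x) (grad w j x)) +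
        ∫ x in (Ω : Set Plane), inner ℂ (w x) (fderiv ℝ (fun x => ν x j) x (basisVec j) • w x) := by
    intro j
    have c1 : Continuous fun x => (inner ℂ (grad w j x) (ν x j • w x) : ℂ) :=
      (continuous_grad hw j).inner (hνw j).continuous
    have c2 : Continuous fun x => (inner ℂ (ν x j • w x) (grad w j x) : ℂ) :=
      (hνw j).continuous.inner (continuous_grad hw j)
    have c3 : Continuous fun x =>
        (inner ℂ (w x) (fderiv ℝ (fun x => ν x j) x (basisVec j) • w x) : ℂ) :=
      hw.continuous.inner
        ((((hνj j).continuous_fderiv (by simp)).clm_apply continuous_const).smul hw.continuous)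
    have c12 : Continuous fun x => (inner ℂ (grad w j x) (ν x j • w x) : ℂ) +
        inner ℂ (ν x j • w x) (grad w j x) := c1.add c2
    rw [← divergence_theorem Γ hbdd hC3 (hG j) (basisVec j),
      ← integral_add (integrableOn_of_continuous hbdd c1) (integrableOn_of_continuous hbdd c2),
      ← integral_add (integrableOn_of_continuous hbdd c12)
        (integrableOn_of_continuous hbdd c3)]
    simp only [hd]
  simp only [← hflux, BoundaryParam.flux]
  rw [Finset.sum_comm]
  refine Finset.sum_congr rfl fun k _ => ?_
  rw [← intervalIntegral.integral_finsetSum, intervalIntegral.integral_of_le (Γ.L_pos k).le]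
  · refine integral_congr_ae (Eventually.of_forall fun s => ?_)
    simp only [Fin.sum_univ_two, hν, normalComp, inner_smul_right_eq_smul, smul_smul, ← add_smul]
    refine (one_smul ℝ _).symm.trans ?_
    congr 1
    have := Real.cos_sq_add_sin_sq (Γ.α k s)
    simp [normalVec]
    linarith
  · intro j _
    exact ((Γ.continuous_normalComp k _).smul
      ((hG j).continuous.comp (Γ.contDiff_γ k).continuous)).intervalIntegrable _ _

/-- The boundary norm of an approximating function is a sum of integrals over `Ω`, each with `w` as
a factor up to bounded coefficients and the other factor `w` or `∂w`. All of them tend to zero when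
`w → 0` in `H¹`. -/
theorem BoundaryParam.IsTrace.eq_zero {Γ : BoundaryParam Ω}
    (hbdd : Bornology.IsBounded (Ω : Set Plane)) (hC3 : HasC3Boundary Ω) {h : Γ.L2Boundary}
    (hh : Γ.IsTrace 0 h) : h = 0 := by
  obtain ⟨ν, hν1, hν⟩ := Γ.exists_contDiff_normal hC3
  obtain ⟨w, hw, h0, h1, h2⟩ := hh.exists_approx hbdd
  have hw1 : ∀ n, ContDiff ℝ 1 (w n) := fun n => (hw n).of_le (by exact_mod_cast le_top)
  have hz : ∀ z : L2 Ω, z = 0 → z =ᵐ[volume.restrict (Ω : Set Plane)] fun _ => (0 : Spinor) := by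
    rintro z rfl
    exact Lp.coeFn_zero _ _ _
  replace h0 := h0.congr_lim (hz _ rfl)
  replace h1 := fun j => (h1 j).congr_lim (hz _ (map_zero _))
  have hνj : ∀ j, ContDiff ℝ 1 (fun x => ν x j) := contDiff_euclidean.1 hν1
  have hf1 := fun j => h0.continuous_field hbdd
    (B := fun x => ν x j • ContinuousLinearMap.id ℂ Spinor)
    ((hνj j).continuous.smul continuous_const)
  have hf2 := fun j => h0.continuous_field hbdd
    (B := fun x => fderiv ℝ (fun x => ν x j) x (basisVec j) • ContinuousLinearMap.id ℂ Spinor)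
    ((((hνj j).continuous_fderiv (by simp)).clm_apply continuous_const).smul continuous_const)
  have hlim : Tendsto (fun n => ∑ j : Fin 2,
      ((∫ x in (Ω : Set Plane), inner ℂ (grad (w n) j x) (ν x j • w n x)) +
        (∫ x in (Ω : Set Plane), inner ℂ (ν x j • w n x) (grad (w n) j x)) +
        ∫ x in (Ω : Set Plane),
          inner ℂ (w n x) (fderiv ℝ (fun x => ν x j) x (basisVec j) • w n x))) atTop (𝓝 0) := by
    have : (0 : ℂ) = ∑ j : Fin 2, (0 + 0 + 0) := by simp
    rw [this]
    refine tendsto_finsetSum _ fun j _ => ((?_ : Tendsto _ _ _).add ?_).add ?_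
    · simpa using (h1 j).inner (hf1 j)
    · simpa using (hf1 j).inner (h1 j)
    · simpa using h0.inner (hf2 j)
  simp_rw [← sum_boundary_norm_sq Γ hbdd hC3 hν1 hν (hw1 _)] at hlim
  have hlim2 : Tendsto (fun n => ∑ k, ∫ s, inner ℂ (w n (Γ.γ k s)) (w n (Γ.γ k s)) ∂Γ.arcMeasure k)
      atTop (𝓝 (∑ k, inner ℂ (h k) (h k))) := by
    refine tendsto_finsetSum _ fun k _ => ?_
    rw [L2.inner_def]
    exact (h2 k).inner (h2 k)
  have hsum := congrArg Complex.re (tendsto_nhds_unique hlim2 hlim)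
  rw [Complex.re_sum, Complex.zero_re, Finset.sum_eq_zero_iff_of_nonneg] at hsum
  · funext k
    have := hsum k (Finset.mem_univ k)
    rw [← RCLike.re_eq_complex_re, inner_self_eq_norm_sq] at this
    simpa using this
  · intro k _
    exact inner_self_nonneg (𝕜 := ℂ)

theorem BoundaryParam.IsTrace.unique {Γ : BoundaryParam Ω}
    (hbdd : Bornology.IsBounded (Ω : Set Plane)) (hC3 : HasC3Boundary Ω) {φ : sobolevH1 Ω}
    {g g' : Γ.L2Boundary} (h : Γ.IsTrace φ g) (h' : Γ.IsTrace φ g') : g = g' := by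
  have h2 := h.add (h'.smul (-1))
  rw [neg_one_smul, add_neg_cancel, neg_one_smul] at h2
  exact add_neg_eq_zero.1 (h2.eq_zero hbdd hC3)

/-! ### Passage to the limit -/

theorem tendsto_wedge {a b : ℕ → Fin 2 → Plane → Spinor} {a₀ b₀ : Fin 2 → Plane → Spinor}
    (ha : ∀ j, L2Tendsto (volume.restrict (Ω : Set Plane)) (fun n => a n j) (a₀ j))
    (hb : ∀ j, L2Tendsto (volume.restrict (Ω : Set Plane)) (fun n => b n j) (b₀ j)) :
    Tendsto (fun n => wedge Ω (a n) (b n)) atTop (𝓝 (wedge Ω a₀ b₀)) :=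
  ((ha 0).inner ((hb 1).clm iSigma3)).sub ((ha 1).inner ((hb 0).clm iSigma3))

/-- The partial derivatives of `M φ`, given `φ` and its partial derivatives `D`. -/
def fieldGrad (M : Plane → Spinor →L[ℂ] Spinor) (φ : Plane → Spinor) (D : Fin 2 → Plane → Spinor)
    (j : Fin 2) (x : Plane) : Spinor :=
  fderiv ℝ M x (basisVec j) (φ x) + M x (D j x)

theorem grad_field {M : Plane → Spinor →L[ℂ] Spinor} (hM : ContDiff ℝ 1 M) {u : Plane → Spinor}
    (hu : ContDiff ℝ 1 u) : grad (fun x => M x (u x)) = fieldGrad M u (grad u) := by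
  funext j x
  have h1 : HasFDerivAt (fun x => (M x).restrictScalars ℝ)
      ((ContinuousLinearMap.restrictScalarsL ℂ Spinor Spinor ℝ ℝ).comp (fderiv ℝ M x)) x :=
    (ContinuousLinearMap.restrictScalarsL ℂ Spinor Spinor ℝ ℝ).hasFDerivAt.comp x
      (hM.differentiable (by simp) x).hasFDerivAt
  have h2 := h1.clm_apply (hu.differentiable (by simp) x).hasFDerivAt
  have h3 : HasFDerivAt (fun x => M x (u x)) _ x := h2
  rw [grad, h3.fderiv, fieldGrad, add_comm]
  rfl

/-- The form `∫ ⟨∂₁φ, i σ₃ ∂₂φ⟩ - ⟨∂₂φ, i σ₃ ∂₁φ⟩` for `φ ∈ D_∞` is a boundary integral. -/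
theorem re_wedge_eq (hbdd : Bornology.IsBounded (Ω : Set Plane)) (hC3 : HasC3Boundary Ω)
    {φ : sobolevH1 Ω} {g : Γ.L2Boundary} (hg : Γ.IsTrace φ g)
    (hA : ∀ k, ∀ᵐ s ∂(Γ.arcMeasure k), normalMat (normalVec (Γ.α k s)) (g k s) = g k s) :
    (wedge Ω (fun j => weakPartial Ω j φ) (fun j => weakPartial Ω j φ)).re =
      1 / 2 * ∑ k, (∫ s, inner ℂ (g k s) (deriv (Γ.α k) s • g k s) ∂Γ.arcMeasure k).re := by
  obtain ⟨ν, hν1, hν⟩ := Γ.exists_contDiff_normal hC3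
  obtain ⟨u, hu, h0, h1, h2⟩ := hg.exists_approx hbdd
  have hu1 : ∀ n, ContDiff ℝ 1 (u n) := fun n => (hu n).of_le (by exact_mod_cast le_top)
  have hu2 : ∀ n, ContDiff ℝ 2 (u n) := fun n => contDiff_infty.1 (hu n) 2
  set M : Plane → Spinor →L[ℂ] Spinor := fun x => normalMat (ν x) with hM
  have hM1 : ContDiff ℝ 1 M := contDiff_normalMat hν1
  set D : Fin 2 → Plane → Spinor := fun j => weakPartial Ω j φ with hD
  set V := fieldGrad M (φ : L2 Ω) D with hV
  have hMu : ∀ n, ContDiff ℝ 1 (fun x => M x (u n x)) := by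
    intro n
    exact ((ContinuousLinearMap.restrictScalarsL ℂ Spinor Spinor ℝ ℝ).contDiff.comp hM1).clm_apply
      (hu1 n)
  have hVlim : ∀ j, L2Tendsto (volume.restrict (Ω : Set Plane))
      (fun n => grad (fun x => M x (u n x)) j) (V j) := by
    intro j
    simp_rw [grad_field hM1 (hu1 _)]
    exact (h0.continuous_field hbdd ((hM1.continuous_fderiv (by simp)).clm_apply
      continuous_const)).add ((h1 j).continuous_field hbdd hM1.continuous)
  -- The boundary condition enters here: `M uₙ` has the same limit on the boundary as `uₙ`.
  have hMarc : ∀ k, L2Tendsto (Γ.arcMeasure k)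
      (fun n s => M (Γ.γ k s) (u n (Γ.γ k s))) (g k) := by
    intro k
    refine ((h2 k).continuous_field_arc Γ
      (hM1.continuous.comp (Γ.contDiff_γ k).continuous)).congr_lim ?_
    filter_upwards [hA k] with s hs
    simpa [hM, hν] using hs
  -- against a fixed smooth function, `M φ` and `φ` give the same form
  have hfix : ∀ m, wedge Ω V (grad (u m)) = wedge Ω D (grad (u m)) := by
    intro m
    have hconst : ∀ j, L2Tendsto (volume.restrict (Ω : Set Plane)) (fun _ => grad (u m) j)
        (grad (u m) j) := fun j =>
      L2Tendsto.const (memLp_of_continuous hbdd (continuous_grad (hu1 m) j))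
    have l1 := tendsto_wedge hVlim hconst
    have l2 := tendsto_wedge h1 hconst
    simp_rw [green_formula Γ hbdd hC3 (hMu _) (hu2 m)] at l1
    simp_rw [green_formula Γ hbdd hC3 (hu1 _) (hu2 m)] at l2
    have hT : ∀ k, L2Tendsto (Γ.arcMeasure k)
        (fun _ s => iSigma3 (fderiv ℝ (u m) (Γ.γ k s) (tangentVec (Γ.α k s))))
        (fun s => iSigma3 (fderiv ℝ (u m) (Γ.γ k s) (tangentVec (Γ.α k s)))) := fun k =>
      L2Tendsto.const (Γ.memLp_arc k (iSigma3.continuous.comp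
        ((((hu1 m).continuous_fderiv (by simp)).comp (Γ.contDiff_γ k).continuous).clm_apply
          (Γ.continuous_tangentVec k))))
    have l3 := tendsto_finsetSum Finset.univ fun k _ => (hMarc k).inner (hT k)
    have l4 := tendsto_finsetSum Finset.univ fun k _ => (h2 k).inner (hT k)
    exact (tendsto_nhds_unique l1 l3).trans (tendsto_nhds_unique l2 l4).symm
  -- Now let the fixed smooth function tend to `φ` in `H¹`.
  have hVD : wedge Ω V D = wedge Ω D D := by
    have l1 := tendsto_wedge (a := fun _ => V) (fun j => L2Tendsto.const (hVlim j).memLp_lim) h1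
    have l2 := tendsto_wedge (a := fun _ => D) (fun j => L2Tendsto.const (h1 j).memLp_lim) h1
    exact tendsto_nhds_unique l1 (l2.congr fun m => (hfix m).symm)
  rw [← hVD]
  have l1 := (Complex.continuous_re.tendsto _).comp (tendsto_wedge hVlim h1)
  have hform : ∀ n, (wedge Ω (grad fun x => M x (u n x)) (grad (u n))).re = _ := fun n =>
    (congrArg Complex.re (green_formula Γ hbdd hC3 (hMu n) (hu2 n))).trans
      (re_bdForm_normalMat Γ hν (hu2 n))
  -- For each `n` the boundary form contains no derivative of `uₙ`, so `L²` convergence on the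
  -- boundary suffices for the limit.
  refine tendsto_nhds_unique (l1.congr hform) (Tendsto.const_mul _ (tendsto_finsetSum _ fun k _ => ?_))
  refine (Complex.continuous_re.tendsto _).comp ?_
  have hα := (h2 k).continuous_field_arc Γ
    (B := fun s => deriv (Γ.α k) s • ContinuousLinearMap.id ℂ Spinor)
    ((Γ.continuous_deriv_α k).smul continuous_const)
  have := (hMarc k).inner hα
  simpa [hM, hν] using this

end Graphene

end

/-! ### The energy identity -/

theorem lemma2p3 (Ω : TopologicalSpace.Opens Graphene.Plane)
    (hconn : IsConnected (Ω : Set Graphene.Plane))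
    (hbdd : Bornology.IsBounded (Ω : Set Graphene.Plane))
    (hC3 : Graphene.HasC3Boundary Ω)
    (Γ : Graphene.BoundaryParam Ω)
    (φ : Graphene.domInfty Γ)
    (g : Γ.L2Boundary) (hg : Γ.IsTrace (φ : Graphene.sobolevH1 Ω) g) :
    ‖Graphene.HInfty Γ φ‖ ^ 2 =
      (∫ x in (Ω : Set Graphene.Plane),
        ∑ j : Fin 2, ‖Graphene.weakPartial Ω j (φ : Graphene.sobolevH1 Ω) x‖ ^ 2) +
      1 / 2 * ∑ k : Fin Γ.N, ∫ s in (0 : ℝ)..Γ.L k, deriv (Γ.α k) s * ‖g k s‖ ^ 2 := by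
  obtain ⟨g', hg', hP⟩ := φ.2
  -- Membership in `D_∞` gives the boundary condition for some trace; by uniqueness it is the given
  -- one.
  obtain rfl := hg'.unique hbdd hC3 hg
  have hA : ∀ k, ∀ᵐ s ∂(Γ.arcMeasure k),
      Graphene.normalMat (Graphene.normalVec (Γ.α k s)) (g' k s) = g' k s := fun k =>
    (hP k).mono fun s hs => Graphene.matAct_bdMatrix_of_projMinus hs
  have hw := Graphene.re_wedge_eq Γ hbdd hC3 hg hA
  set D := fun j => Graphene.weakPartial Ω j (φ : Graphene.sobolevH1 Ω) with hD
  have hDm : ∀ j, MemLp (D j) 2 (volume.restrict (Ω : Set Graphene.Plane)) := fun j => Lp.memLp _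
  have hJm : ∀ j, MemLp (fun x => Graphene.iSigma3 (D j x)) 2
      (volume.restrict (Ω : Set Graphene.Plane)) := fun j =>
    Graphene.memLp_field_apply (B := fun _ => Graphene.iSigma3) aestronglyMeasurable_const
      (C := ‖Graphene.iSigma3‖) (by simp) (hDm j)
  have hnorm : ‖Graphene.HInfty Γ φ‖ ^ 2 =
      ∫ x in (Ω : Set Graphene.Plane), ‖Graphene.HInfty Γ φ x‖ ^ 2 := by
    rw [← inner_self_eq_norm_sq (𝕜 := ℂ), L2.inner_def, ← integral_re (L2.integrable_inner _ _)]
    simp only [inner_self_eq_norm_sq]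
  have hH : ∀ᵐ x ∂(volume.restrict (Ω : Set Graphene.Plane)), Graphene.HInfty Γ φ x =
      (1 / Complex.I) • (Graphene.matAct (Graphene.pauli 0) (D 0 x) +
        Graphene.matAct (Graphene.pauli 1) (D 1 x)) := by
    have e : Graphene.HInfty Γ φ = (1 / Complex.I) •
        ((Graphene.matAct (Graphene.pauli 0)).compLpL 2
          (volume.restrict (Ω : Set Graphene.Plane)) (D 0) +
        (Graphene.matAct (Graphene.pauli 1)).compLpL 2
          (volume.restrict (Ω : Set Graphene.Plane)) (D 1)) := by
      simp [Graphene.HInfty, Graphene.diracT, hD]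
    rw [e]
    filter_upwards [Lp.coeFn_smul (1 / Complex.I) ((Graphene.matAct (Graphene.pauli 0)).compLpL 2
          (volume.restrict (Ω : Set Graphene.Plane)) (D 0) +
        (Graphene.matAct (Graphene.pauli 1)).compLpL 2
          (volume.restrict (Ω : Set Graphene.Plane)) (D 1)),
      Lp.coeFn_add ((Graphene.matAct (Graphene.pauli 0)).compLpL 2
          (volume.restrict (Ω : Set Graphene.Plane)) (D 0))
        ((Graphene.matAct (Graphene.pauli 1)).compLpL 2
          (volume.restrict (Ω : Set Graphene.Plane)) (D 1)),
      (Graphene.matAct (Graphene.pauli 0)).coeFn_compLpL (D 0),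
      (Graphene.matAct (Graphene.pauli 1)).coeFn_compLpL (D 1)] with x h1 h2 h3 h4
    rw [h1, Pi.smul_apply, h2, Pi.add_apply, h3, h4]
  have hbd : ∀ k, (∫ s, inner ℂ (g' k s) (deriv (Γ.α k) s • g' k s) ∂Γ.arcMeasure k).re =
      ∫ s in (0 : ℝ)..Γ.L k, deriv (Γ.α k) s * ‖g' k s‖ ^ 2 := by
    intro k
    have hs : ∀ s, (inner ℂ (g' k s) (deriv (Γ.α k) s • g' k s) : ℂ) =
        ((deriv (Γ.α k) s * ‖g' k s‖ ^ 2 : ℝ) : ℂ) := by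
      intro s
      rw [inner_smul_right_eq_smul, inner_self_eq_norm_sq_to_K]
      simp
    rw [intervalIntegral.integral_of_le (Γ.L_pos k).le]
    simp only [hs]
    rw [integral_complex_ofReal, Complex.ofReal_re]
  have hi : ∀ i j, Integrable (fun x => (inner ℂ (D i x) (Graphene.iSigma3 (D j x)) : ℂ))
      (volume.restrict (Ω : Set Graphene.Plane)) := fun i j =>
    Graphene.integrable_inner_of_memLp (hDm i) (hJm j)
  have hsq : ∀ j, Integrable (fun x => ‖D j x‖ ^ 2)
      (volume.restrict (Ω : Set Graphene.Plane)) := fun j =>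
    (memLp_two_iff_integrable_sq_norm (hDm j).1).1 (hDm j)
  simp only [hbd] at hw
  have hwre : (Graphene.wedge Ω (fun j => D j) (fun j => D j)).re =
      ∫ x in (Ω : Set Graphene.Plane), (inner ℂ (D 0 x) (Graphene.iSigma3 (D 1 x)) -
        inner ℂ (D 1 x) (Graphene.iSigma3 (D 0 x)) : ℂ).re := by
    rw [Graphene.wedge, ← integral_sub (hi 0 1) (hi 1 0)]
    exact (integral_re ((hi 0 1).sub (hi 1 0))).symm
  -- Both sides are now integrals over `Ω`, and they agree pointwise by `norm_sq_dirac`.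
  rw [← hw, hwre, hnorm, ← integral_add]
  · refine integral_congr_ae ?_
    filter_upwards [hH] with x hx
    rw [hx, Graphene.norm_sq_dirac, Fin.sum_univ_two]
  · simp only [Fin.sum_univ_two]
    exact (hsq 0).add (hsq 1)
  · exact ((hi 0 1).sub (hi 1 0)).re
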